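/- **Definitions.** Consider families $f=(f_n)$ of symmetric functions $f_n:\Sigma_n^n\to\Sigma_n$ ($f_n(\pi(\mathbf x))=f_n(\mathbf x)$ for all permutations $\pi$), where each $\Sigma_n$ is a nonempty finite alphabet; conditions are imposed for all $n\ge 1$. A *streaming algorithm* $s=(\sigma,\eta)$ consists of a finite set $Q$ of states with a starting state $0$ and maps $\sigma:Q\times\Sigma\to Q$, $\eta:Q\to\Sigma$; on input $\mathbf x=(x_1,\dots,x_n)$ it reaches the state $s(\mathbf x)=\sigma(\cdots\sigma(\sigma(0,x_1),x_2)\cdots,x_n)$ and outputs $\eta(s(\mathbf x))$. A *mud algorithm* $m=(\Phi,\oplus,\eta)$ consists of a finite set $Q$ of messages and maps $\Phi:\Sigma\to Q$, $\oplus:Q\times Q\to Q$, $\eta:Q\to\Sigma$; for a computation tree $\mathcal T$ (a binary tree with $n$ leaves, to which the $n$ inputs are assigned by an arbitrary permutation) $m_{\mathcal T}(\mathbf x)$ is the result of applying $\oplus$ along $\mathcal T$ to the messages $\Phi(x_1),\dots,\Phi(x_n)$ at the leaves, and the output is $\eta(m_{\mathcal T}(\mathbf x))$. The communication complexity is $\log_2|Q|$;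 the space complexity is the maximum of the space complexities of the component functions ($\sigma,\eta$, respectively $\Phi,\oplus,\eta$). For families of algorithms indexed by $n$ and a public random string $R\in\{0,1\}^{k(n)}$, "$\mathrm{polylog}(n)$-space" means that each component function is computed within $\mathrm{polylog}(n)$ bits of space, inputs included, by one program which is the same for all $n$ and $R$ and receives $n$, $|\Sigma_n|$ and $R$ in addition to its arguments; states, messages and letters are numbered consecutively from $0$. * $f\in\mathrm{rSS}$ if there are $k=\mathrm{polylog}(n)$ and $\mathrm{polylog}(n)$-communication, $\mathrm{polylog}(n)$-space streaming algorithms $s^R=(\sigma^R,\eta^R)$, $R\in\{0,1\}^k$, such that for all $\mathbf x\in\Sigma_n^n$: (1) $\Pr_{R}[\eta^R(s^R(\mathbf x))=f_n(\mathbf x)]\ge 2/3$ for uniformly random $R$; and (2) $\eta^R(s^R(\mathbf x))=\eta^R(s^R(\pi(\mathbf x)))$ for all $R$ and all permutations $\pi$. * $f\in\mathrm{rMUD}$ if there are $k=\mathrm{polylog}(n)$ and $\mathrm{polylog}(n)$-communication, $\mathrm{polylog}(n)$-space mud algorithms $m^R=(\Phi^R,\oplus^R,\eta^R)$, $R\in\{0,1\}^k$,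 such that for all $\mathbf x\in\Sigma_n^n$: (1) for every computation tree $\mathcal T$, $\Pr_{R}[\eta^R(m^R_{\mathcal T}(\mathbf x))=f_n(\mathbf x)]\ge 2/3$; and (2) $\eta^R(m^R_{\mathcal T}(\mathbf x))=\eta^R(m^R_{\mathcal T'}(\pi(\mathbf x)))$ for all $R$, all permutations $\pi$ and all computation trees $\mathcal T,\mathcal T'$. **Theorem.** $\mathrm{rMUD}=\mathrm{rSS}$. -/

import Mathlib

/-!  ## A machine model with a space measure

Programs act on finitely many registers that hold natural numbers in binary. The space in use is the
total number of bits of the register contents, inputs included. Up to a constant factor this is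
the space of a Turing machine. -/

/-- The arithmetic instructions; each can be carried out in space linear in the bits of its
operands. Subtraction is truncated at `0`, division is rounded down. -/
inductive ArithOp where
  | add | sub | mul | div | mod

/-- The value of an arithmetic instruction. -/
def ArithOp.eval : ArithOp → ℕ → ℕ → ℕ
  | .add, a, b => a + b
  | .sub, a, b => a - b
  | .mul, a, b => a * b
  | .div, a, b => a / b
  | .mod, a, b => a % b

/-- Structured register programs. -/
inductive Prog where
  /-- do nothing -/
  | skip : Prog
  /-- write the constant `c` into register `i` -/
  | const (i c : ℕ) : Prog
  /-- write the value of `o` on the contents of registers `a`, `b` into register `i` -/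
  | arith (o : ArithOp) (i a b : ℕ) : Prog
  /-- run `p`, then `q` -/
  | seq (p q : Prog) : Prog
  /-- run `p` if register `i` is nonzero, and `q` otherwise -/
  | branch (i : ℕ) (p q : Prog) : Prog
  /-- run `p` as long as register `i` is nonzero -/
  | loop (i : ℕ) (p : Prog) : Prog

/-- The contents of the registers. -/
abbrev Store := ℕ → ℕ

/-- All registers that the program mentions have an index below `p.width`. -/
def Prog.width : Prog → ℕ
  | .skip => 0
  | .const i _ => i + 1
  | .arith _ i a b => max (i + 1) (max (a + 1) (b + 1))
  | .seq p q => max p.width q.width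
  | .branch i p q => max (i + 1) (max p.width q.width)
  | .loop i p => max (i + 1) p.width

/-- The total number of bits in the first `w` registers. -/
def Store.bits (w : ℕ) (m : Store) : ℕ := ∑ i ∈ Finset.range w, (m i).size

/-- `Runs w s p m m'`: the program `p`, started on the store `m`, halts with the store `m'`, and
at every moment of the run the first `w` registers hold at most `s` bits in total. -/
inductive Runs (w s : ℕ) : Prog → Store → Store → Prop
  | skip (m : Store) : m.bits w ≤ s → Runs w s .skip m m
  | const (i c : ℕ) (m : Store) :
      m.bits w ≤ s → Store.bits w (Function.update m i c) ≤ s →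
      Runs w s (.const i c) m (Function.update m i c)
  | arith (o : ArithOp) (i a b : ℕ) (m : Store) :
      m.bits w ≤ s → Store.bits w (Function.update m i (o.eval (m a) (m b))) ≤ s →
      Runs w s (.arith o i a b) m (Function.update m i (o.eval (m a) (m b)))
  | seq (p q : Prog) (m₁ m₂ m₃ : Store) :
      Runs w s p m₁ m₂ → Runs w s q m₂ m₃ → Runs w s (.seq p q) m₁ m₃
  | branch_then (i : ℕ) (p q : Prog) (m m' : Store) :
      m i ≠ 0 → Runs w s p m m' → Runs w s (.branch i p q) m m'
  | branch_else (i : ℕ) (p q : Prog) (m m' : Store) :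
      m i = 0 → Runs w s q m m' → Runs w s (.branch i p q) m m'
  | loop_done (i : ℕ) (p : Prog) (m : Store) :
      m i = 0 → m.bits w ≤ s → Runs w s (.loop i p) m m
  | loop_step (i : ℕ) (p : Prog) (m₁ m₂ m₃ : Store) :
      m₁ i ≠ 0 → Runs w s p m₁ m₂ → Runs w s (.loop i p) m₂ m₃ →
      Runs w s (.loop i p) m₁ m₃

/-- The program `p`, started with the list `inputs` in its first registers and `0` in all others,
halts with `out` in register `0`, and never uses more than `s` bits of space. -/
def Prog.ComputesInSpace (p : Prog) (s : ℕ) (inputs : List ℕ) (out : ℕ) : Prop :=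
  ∃ m : Store, Runs (max p.width inputs.length) s p (fun i => inputs.getD i 0) m ∧ m 0 = out

/-- A quantity depending on `n` is `polylog(n)` if for some `C` it is at most `polylog C n`
for all `n ≥ 1`. -/
def polylog (C n : ℕ) : ℕ := C * (Nat.log 2 n + 1) ^ C

/-! ## Symmetric functions -/

/-- A family of symmetric functions `Σₙⁿ → Σₙ`, where the nonempty finite alphabet `Σₙ` may depend
on `n` and its letters are numbered `0, …, |Σₙ| - 1`. -/
structure SymmetricFamily where
  /-- the size of the alphabet -/
  alphabetSize : ℕ → ℕ
  alphabetSize_pos : ∀ n, 0 < alphabetSize n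
  /-- the function to be computed -/
  toFun : ∀ n, (Fin n → Fin (alphabetSize n)) → Fin (alphabetSize n)
  symmetric : ∀ n (x : Fin n → Fin (alphabetSize n)) (π : Equiv.Perm (Fin n)),
    toFun n (x ∘ π) = toFun n x

/-! ## Streaming algorithms -/

/-- A streaming algorithm `(σ, η)` over an alphabet of `S` letters. Its states are numbered
`0, …, |Q| - 1`, and `0` is the starting state. -/
structure StreamingAlg (S : ℕ) where
  /-- the number `|Q|` of states -/
  card : ℕ
  card_pos : 0 < card
  /-- the operator `σ` -/
  update : Fin card → Fin S → Fin card
  /-- the operator `η` -/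
  output : Fin card → Fin S

/-- The state reached from `q` by reading a stream in the given order. -/
def StreamingAlg.run {S : ℕ} (s : StreamingAlg S) (q : Fin s.card) (x : List (Fin S)) :
    Fin s.card := x.foldl s.update q

/-- The output on the input `x₁, …, xₙ`. -/
def StreamingAlg.result {S n : ℕ} (s : StreamingAlg S) (x : Fin n → Fin S) : Fin S :=
  s.output (s.run ⟨0, s.card_pos⟩ (List.ofFn x))

/-! ## Mud algorithms -/

/-- A mud algorithm `(Φ, ⊕, η)` over an alphabet of `S` letters. Its messages are numbered
`0, …, |Q| - 1`. -/
structure MudAlg (S : ℕ) where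
  /-- the number `|Q|` of messages -/
  card : ℕ
  /-- the local function `Φ` -/
  localMsg : Fin S → Fin card
  /-- the aggregator `⊕` -/
  aggregate : Fin card → Fin card → Fin card
  /-- the post-processing operator `η` -/
  output : Fin card → Fin S

/-- Binary trees with labelled leaves. -/
inductive BinTree (ι : Type) where
  | leaf (i : ι) : BinTree ι
  | node (l r : BinTree ι) : BinTree ι

/-- The labels of the leaves, from left to right. -/
def BinTree.leaves {ι : Type} : BinTree ι → List ι
  | .leaf i => [i]
  | .node l r => l.leaves ++ r.leaves

/-- A computation tree for `n` inputs: a binary tree with `n` leaves, to which the `n` inputs are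
assigned by an arbitrary permutation. -/
def CompTree (n : ℕ) : Type := {T : BinTree (Fin n) // T.leaves.Perm (List.finRange n)}

/-- The message computed at the root of a tree. -/
def MudAlg.eval {S n : ℕ} (m : MudAlg S) (x : Fin n → Fin S) : BinTree (Fin n) → Fin m.card
  | .leaf i => m.localMsg (x i)
  | .node l r => m.aggregate (m.eval x l) (m.eval x r)

/-- The output along the computation tree `T` on the input `x₁, …, xₙ`. -/
def MudAlg.result {S n : ℕ} (m : MudAlg S) (T : CompTree n) (x : Fin n → Fin S) : Fin S :=
  m.output (m.eval x T.1)

/-! ## Randomized algorithms with public randomness -/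

/-- The probability of the event `E` for a uniformly random string of `k` bits. -/
noncomputable def coinProb {k : ℕ} (E : Set (Fin k → Bool)) : ℝ :=
  (E.ncard : ℝ) / 2 ^ k

/-- The parameters every component of an algorithm has access to: the number `n` of inputs, the size
`S` of the alphabet, and the public random string `R` (its length and its bits). -/
def params (n S : ℕ) {k : ℕ} (R : Fin k → Bool) : List ℕ := [n, S, k, Nat.ofBits R]

/-- `{sᴿ}` is a family of `polylog(n)`-communication, `polylog(n)`-space streaming algorithms with
`k = polylog(n)` random bits. The space bound is that of one program for `σ` and one
for `η`, which receive `n`, the alphabet size and the random string `R` as parameters. -/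
def StreamingPolylog (S k : ℕ → ℕ) (s : ∀ n, (Fin (k n) → Bool) → StreamingAlg (S n)) : Prop :=
  ∃ (C : ℕ) (pσ pη : Prog), ∀ n, 1 ≤ n →
    k n ≤ polylog C n ∧
    ∀ R : Fin (k n) → Bool,
      Nat.clog 2 (s n R).card ≤ polylog C n ∧
      (∀ (q : Fin (s n R).card) (a : Fin (S n)),
        pσ.ComputesInSpace (polylog C n) (params n (S n) R ++ [q.val, a.val])
          ((s n R).update q a).val) ∧
      (∀ q : Fin (s n R).card,
        pη.ComputesInSpace (polylog C n) (params n (S n) R ++ [q.val]) ((s n R).output q).val)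

/-- `{mᴿ}` is a family of `polylog(n)`-communication, `polylog(n)`-space mud algorithms with
`k = polylog(n)` random bits. The space bound is that of one program for each of `Φ`, `⊕`
and `η`, which receive `n`, the alphabet size and the random string `R` as parameters. -/
def MudPolylog (S k : ℕ → ℕ) (m : ∀ n, (Fin (k n) → Bool) → MudAlg (S n)) : Prop :=
  ∃ (C : ℕ) (pΦ pAgg pη : Prog), ∀ n, 1 ≤ n →
    k n ≤ polylog C n ∧
    ∀ R : Fin (k n) → Bool,
      Nat.clog 2 (m n R).card ≤ polylog C n ∧
      (∀ a : Fin (S n),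
        pΦ.ComputesInSpace (polylog C n) (params n (S n) R ++ [a.val])
          ((m n R).localMsg a).val) ∧
      (∀ q q' : Fin (m n R).card,
        pAgg.ComputesInSpace (polylog C n) (params n (S n) R ++ [q.val, q'.val])
          ((m n R).aggregate q q').val) ∧
      (∀ q : Fin (m n R).card,
        pη.ComputesInSpace (polylog C n) (params n (S n) R ++ [q.val]) ((m n R).output q).val)

/-- The class of symmetric functions computed by randomized streaming algorithms with public
randomness that are order-independent for every fixed random string. -/
def rSS : Set SymmetricFamily :=
  {f | ∃ (k : ℕ → ℕ) (s : ∀ n, (Fin (k n) → Bool) → StreamingAlg (f.alphabetSize n)),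
    StreamingPolylog f.alphabetSize k s ∧
    ∀ n, 1 ≤ n → ∀ x : Fin n → Fin (f.alphabetSize n),
      (2 / 3 : ℝ) ≤ coinProb {R | (s n R).result x = f.toFun n x} ∧
      ∀ (R : Fin (k n) → Bool) (π : Equiv.Perm (Fin n)),
        (s n R).result x = (s n R).result (x ∘ π)}

/-- The class of symmetric functions computed by randomized mud algorithms with public
randomness that are independent of the order and of the tree for every fixed random string. -/
def rMUD : Set SymmetricFamily :=
  {f | ∃ (k : ℕ → ℕ) (m : ∀ n, (Fin (k n) → Bool) → MudAlg (f.alphabetSize n)),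
    MudPolylog f.alphabetSize k m ∧
    ∀ n, 1 ≤ n → ∀ x : Fin n → Fin (f.alphabetSize n),
      (∀ T : CompTree n,
        (2 / 3 : ℝ) ≤ coinProb {R | (m n R).result T x = f.toFun n x}) ∧
      ∀ (R : Fin (k n) → Bool) (π : Equiv.Perm (Fin n)) (T T' : CompTree n),
        (m n R).result T x = (m n R).result T' (x ∘ π)}

/-! From mud to streaming, the messages are aggregated one at a time. This is the mud algorithm
evaluated along a left comb, and independence of the tree for fixed `R` allows any fixed tree in its
place.

From streaming to mud, fix `R`. A message consists of a number of letters and a state that some word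
of that length reaches from the starting state. To combine `(j₁, q₁)` with `(j₂, q₂)`, one takes any
word `y` of the second length that leads from `0` to `q₂`, and reads it from `q₁`. The true second
block need not equal `y`. But order independence allows a block to be moved to the front of the
stream, where only the state it reaches from `0` matters, so exchanging the block for `y` leaves the
final output unchanged (`Represents.join`). Since this holds for each `R` separately, outputs agree
string by string and the success probability is unchanged.

The word `y` may have up to `n` letters and cannot be stored. Only the state reached from `q₁` is
needed, and this is a reachability question in the graph on pairs of states whose edges read one
letter in both components: is `(q₂, q)` reachable from `(0, q₁)` in a prescribed number of steps?
Savitch's recursion on midpoints answers it with depth logarithmic in `n` and frames of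
polylogarithmic size (`SearchData.wp_savitch_loop`). The aggregator tries every `q`
(`SearchData.wp_joinStates`).

Most of the work is to realize this as a register program. The recursion becomes a flat loop with
its stack packed into one number. The given programs are called as subroutines in registers above a
reserved block, so that space is their own space plus a fixed number of registers of polylogarithmic
size (`WP.call`). -/

/-! ## Running a program inside another one -/

/-- The number of registers reserved for a calling program. -/
abbrev lowWidth : ℕ := 32

/-- The program with all registers shifted upwards by `lowWidth`. -/
def Prog.shift : Prog → Prog
  | .skip => .skip
  | .const i c => .const (lowWidth + i) c
  | .arith o i a b => .arith o (lowWidth + i) (lowWidth + a) (lowWidth + b)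
  | .seq p q => .seq p.shift q.shift
  | .branch i p q => .branch (lowWidth + i) p.shift q.shift
  | .loop i p => .loop (lowWidth + i) p.shift

/-- The store with `low` in the reserved registers and `m` in the registers above. -/
def Store.embed (low m : Store) : Store :=
  fun i => if i < lowWidth then low i else m (i - lowWidth)

theorem Store.embed_low (low m : Store) {i : ℕ} (h : i < lowWidth) : low.embed m i = low i :=
  if_pos h

theorem Store.embed_high (low m : Store) (i : ℕ) : low.embed m (lowWidth + i) = m i := by
  simp [Store.embed]

theorem Store.update_embed_high (low m : Store) (i v : ℕ) :
    Function.update (low.embed m) (lowWidth + i) v = low.embed (Function.update m i v) := by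
  funext j
  by_cases hj : j < lowWidth
  · rw [Function.update_of_ne (by omega), Store.embed_low _ _ hj, Store.embed_low _ _ hj]
  · obtain ⟨j, rfl⟩ := Nat.exists_eq_add_of_le (not_lt.mp hj)
    simp [Function.update_apply, Store.embed_high]

theorem Store.update_embed_low (low m : Store) {i : ℕ} (v : ℕ) (h : i < lowWidth) :
    Function.update (low.embed m) i v = Store.embed (Function.update low i v) m := by
  funext j
  by_cases hj : j < lowWidth
  · simp [Function.update_apply, Store.embed_low _ _ hj]
  · obtain ⟨j, rfl⟩ := Nat.exists_eq_add_of_le (not_lt.mp hj)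
    rw [Store.embed_high, Function.update_of_ne (by omega), Store.embed_high]

theorem Store.bits_mono_width {w w' : ℕ} (h : w ≤ w') (m : Store) : m.bits w ≤ m.bits w' :=
  Finset.sum_le_sum_of_subset (Finset.range_subset_range.mpr h)

theorem Store.bits_mono (w : ℕ) {m m' : Store} (h : ∀ i, m i ≤ m' i) : m.bits w ≤ m'.bits w :=
  Finset.sum_le_sum fun i _ => Nat.size_le_size (h i)

theorem Store.size_le_bits {w i : ℕ} (m : Store) (h : i < w) : (m i).size ≤ m.bits w :=
  Finset.single_le_sum (f := fun i => (m i).size) (fun _ _ => Nat.zero_le _)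
    (Finset.mem_range.mpr h)

/-- All registers from `lowWidth + w₀` on are zero and cost no bits. Hence the bound is the same for
every `w`, and the width of a surrounding program never has to be computed. -/
theorem Store.bits_embed_le {b w₀ : ℕ} (w : ℕ) {low m : Store} (hlow : ∀ i < lowWidth, low i < 2 ^ b)
    (hm : ∀ i, w₀ ≤ i → m i = 0) :
    (low.embed m).bits w ≤ m.bits w₀ + lowWidth * b := by
  calc (low.embed m).bits w ≤ (low.embed m).bits (max w (lowWidth + w₀)) :=
        Store.bits_mono_width (le_max_left _ _) _
    _ = (low.embed m).bits (lowWidth + w₀) := by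
        symm
        refine Finset.sum_subset (Finset.range_subset_range.mpr (le_max_right _ _)) ?_
        intro i _ hi
        rw [Finset.mem_range, not_lt] at hi
        obtain ⟨j, rfl⟩ := Nat.exists_eq_add_of_le hi
        rw [add_assoc, Store.embed_high, hm _ (by omega), Nat.size_zero]
    _ = (∑ i ∈ Finset.range lowWidth, (low i).size) + m.bits w₀ := by
        rw [Store.bits, Finset.sum_range_add]
        refine congrArg₂ (· + ·) (Finset.sum_congr rfl fun i hi => ?_)
          (Finset.sum_congr rfl fun i _ => ?_)
        · rw [Store.embed_low _ _ (Finset.mem_range.mp hi)]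
        · rw [Store.embed_high]
    _ ≤ m.bits w₀ + lowWidth * b := by
        rw [add_comm]
        gcongr
        calc _ ≤ ∑ i ∈ Finset.range lowWidth, b := Finset.sum_le_sum fun i hi =>
              Nat.size_le.mpr (hlow i (Finset.mem_range.mp hi))
          _ = lowWidth * b := by simp

theorem Runs.bits_le {w s : ℕ} {p : Prog} {m m' : Store} (h : Runs w s p m m') :
    m.bits w ≤ s ∧ m'.bits w ≤ s := by
  induction h with
  | skip m h => exact ⟨h, h⟩
  | const i c m h h' => exact ⟨h, h'⟩
  | arith o i a b m h h' => exact ⟨h, h'⟩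
  | seq p q m₁ m₂ m₃ _ _ h h' => exact ⟨h.1, h'.2⟩
  | branch_then i p q m m' _ _ h => exact h
  | branch_else i p q m m' _ _ h => exact h
  | loop_done i p m _ h => exact ⟨h, h⟩
  | loop_step i p m₁ m₂ m₃ _ _ _ h h' => exact ⟨h.1, h'.2⟩

/-- A run can be repeated in the upper registers. -/
theorem Runs.embed {w₀ s b : ℕ} {p : Prog} {m m' : Store} (h : Runs w₀ s p m m')
    (hw : p.width ≤ w₀) (hm : ∀ i, w₀ ≤ i → m i = 0) (w : ℕ) {low : Store}
    (hlow : ∀ i < lowWidth, low i < 2 ^ b) :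
    Runs w (s + lowWidth * b) p.shift (low.embed m) (low.embed m') ∧ ∀ i, w₀ ≤ i → m' i = 0 := by
  have key : ∀ m : Store, (∀ i, w₀ ≤ i → m i = 0) → m.bits w₀ ≤ s →
      (low.embed m).bits w ≤ s + lowWidth * b := fun m hm hs =>
    (Store.bits_embed_le w hlow hm).trans (by omega)
  induction h with
  | skip m h => exact ⟨.skip _ (key m hm h), hm⟩
  | const i c m h h' =>
    have hm' : ∀ j, w₀ ≤ j → Function.update m i c j = 0 := by
      intro j hj
      simp only [Prog.width] at hw
      rw [Function.update_of_ne (by omega), hm j hj]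
    refine ⟨?_, hm'⟩
    rw [← Store.update_embed_high]
    refine .const _ _ _ (key _ hm h) ?_
    rw [Store.update_embed_high]
    exact key _ hm' h'
  | arith o i a b m h h' =>
    have hm' : ∀ j, w₀ ≤ j → Function.update m i (o.eval (m a) (m b)) j = 0 := by
      intro j hj
      simp only [Prog.width] at hw
      rw [Function.update_of_ne (by omega), hm j hj]
    refine ⟨?_, hm'⟩
    have := Runs.arith (w := w) (s := s + lowWidth * _) o (lowWidth + i) (lowWidth + a)
      (lowWidth + b) (low.embed m) (key _ hm h)
    simp only [Store.embed_high, Store.update_embed_high] at this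
    exact this (key _ hm' h')
  | seq p q m₁ m₂ m₃ _ _ h h' =>
    simp only [Prog.width] at hw
    obtain ⟨r, h₂⟩ := h (by omega) hm
    obtain ⟨r', h₃⟩ := h' (by omega) h₂
    exact ⟨.seq _ _ _ _ _ r r', h₃⟩
  | branch_then i p q m m' hi _ h =>
    simp only [Prog.width] at hw
    obtain ⟨r, h₂⟩ := h (by omega) hm
    exact ⟨.branch_then _ _ _ _ _ (by rwa [Store.embed_high]) r, h₂⟩
  | branch_else i p q m m' hi _ h =>
    simp only [Prog.width] at hw
    obtain ⟨r, h₂⟩ := h (by omega) hm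
    exact ⟨.branch_else _ _ _ _ _ (by rwa [Store.embed_high]) r, h₂⟩
  | loop_done i p m hi h => exact ⟨.loop_done _ _ _ (by rwa [Store.embed_high]) (key _ hm h), hm⟩
  | loop_step i p m₁ m₂ m₃ hi _ _ h h' =>
    simp only [Prog.width] at hw
    obtain ⟨r, h₂⟩ := h (by omega) hm
    obtain ⟨r', h₃⟩ := h' (by simp only [Prog.width]; omega) h₂
    exact ⟨.loop_step _ _ _ _ _ (by rwa [Store.embed_high]) r r', h₃⟩

theorem Runs.mono_space {w s s' : ℕ} {p : Prog} {m m' : Store} (h : Runs w s p m m')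
    (hs : s ≤ s') : Runs w s' p m m' := by
  induction h with
  | skip m h => exact .skip _ (h.trans hs)
  | const i c m h h' => exact .const _ _ _ (h.trans hs) (h'.trans hs)
  | arith o i a b m h h' => exact .arith _ _ _ _ _ (h.trans hs) (h'.trans hs)
  | seq p q m₁ m₂ m₃ _ _ h h' => exact .seq _ _ _ _ _ h h'
  | branch_then i p q m m' hi _ h => exact .branch_then _ _ _ _ _ hi h
  | branch_else i p q m m' hi _ h => exact .branch_else _ _ _ _ _ hi h
  | loop_done i p m hi h => exact .loop_done _ _ _ hi (h.trans hs)
  | loop_step i p m₁ m₂ m₃ hi _ _ h h' => exact .loop_step _ _ _ _ _ hi h h'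

/-- Copy the contents of the registers in the list to the upper registers from number `j` on, which
are assumed to hold `0`. -/
def Prog.setArgs : ℕ → List ℕ → Prog
  | _, [] => .skip
  | j, a :: l => .seq (.arith .add (lowWidth + j) a (lowWidth + j)) (Prog.setArgs (j + 1) l)

/-- Write `0` into the first `j` upper registers. -/
def Prog.clear : ℕ → Prog
  | 0 => .skip
  | j + 1 => .seq (.const (lowWidth + j) 0) (Prog.clear j)

/-- Run `p` in the upper registers on the contents of the registers `args`, and write its result into
register `o`. -/
def Prog.call (p : Prog) (args : List ℕ) (o : ℕ) : Prog :=
  .seq (Prog.setArgs 0 args) (.seq p.shift (.seq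
    (.seq (.const o 0) (.arith .add o (lowWidth + 0) o)) (Prog.clear (max p.width args.length))))

/-- The list `pre` holds the arguments already copied. Every intermediate store contains a prefix of
the full argument list, so it takes no more space than the full inputs of the called program. -/
theorem runs_setArgs {s b w₀ : ℕ} (w : ℕ) {low : Store} (hlow : ∀ i < lowWidth, low i < 2 ^ b)
    (args : List ℕ) (hargs : ∀ a ∈ args, a < lowWidth) (pre : List ℕ)
    (hw : pre.length + args.length ≤ w₀)
    (hs : Store.bits w₀ (fun i => (pre ++ args.map low).getD i 0) ≤ s) :
    Runs w (s + lowWidth * b) (Prog.setArgs pre.length args)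
      (low.embed fun i => pre.getD i 0) (low.embed fun i => (pre ++ args.map low).getD i 0) := by
  have hb : ∀ l l' : List ℕ, l.length ≤ w₀ → l <+: l' →
      Store.bits w₀ (fun i => l'.getD i 0) ≤ s →
      Store.bits w (low.embed fun i => l.getD i 0) ≤ s + lowWidth * b := by
    intro l l' hl hll hs
    refine (Store.bits_embed_le w (w₀ := w₀) hlow ?_).trans
      (Nat.add_le_add_right ((Store.bits_mono _ ?_).trans hs) _)
    · intro i hi
      simp [List.getD_eq_getElem?_getD, List.getElem?_eq_none (hl.trans hi)]
    · intro i
      obtain ⟨r, rfl⟩ := hll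
      by_cases hi : i < l.length
      · simp [List.getD_eq_getElem?_getD, List.getElem?_append_left hi]
      · simp [List.getD_eq_getElem?_getD, List.getElem?_eq_none (not_lt.mp hi)]
  induction args generalizing pre with
  | nil =>
    simp only [List.map_nil, List.append_nil] at hs ⊢
    exact .skip _ (hb pre pre (by simpa using hw) List.prefix_rfl hs)
  | cons a l ih =>
    have ha : a < lowWidth := hargs a (by simp)
    have e : pre ++ (a :: l).map low = (pre ++ [low a]) ++ l.map low := by simp
    have step : Function.update (low.embed fun i => pre.getD i 0) (lowWidth + pre.length)
        (low a) = low.embed fun i => (pre ++ [low a]).getD i 0 := by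
      rw [Store.update_embed_high]
      congr 1
      funext i
      rcases lt_trichotomy i pre.length with h | h | h
      · rw [Function.update_of_ne h.ne]
        simp [List.getD_eq_getElem?_getD, List.getElem?_append_left h]
      · subst h; simp [List.getD_eq_getElem?_getD]
      · rw [Function.update_of_ne h.ne']
        simp only [List.getD_eq_getElem?_getD]
        rw [List.getElem?_eq_none h.le, List.getElem?_eq_none (by simp; omega)]
    simp only [List.length_cons] at hw
    have hval : ArithOp.eval .add (low.embed (fun i => pre.getD i 0) a)
        (low.embed (fun i => pre.getD i 0) (lowWidth + pre.length)) = low a := by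
      rw [Store.embed_low _ _ ha, Store.embed_high]
      simp [ArithOp.eval, List.getD_eq_getElem?_getD]
    have r := Runs.arith (w := w) (s := s + lowWidth * b) .add (lowWidth + pre.length) a
      (lowWidth + pre.length) (low.embed fun i => pre.getD i 0)
      (hb _ _ (by omega) (List.prefix_append _ _) hs)
    rw [hval, step] at r
    refine .seq _ _ _ _ _ (r (hb _ _ (by simp; omega) (e ▸ List.prefix_append _ _) hs)) ?_
    rw [e] at hs ⊢
    have := ih (fun x hx => hargs x (by simp [hx])) (pre ++ [low a]) (by simp; omega) hs
    simpa using this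

/-- Clearing proceeds from the top register downwards and only decreases contents. It removes what a
called program leaves behind, so that the next call again finds zeros. -/
theorem runs_clear {s b w₀ : ℕ} (w j : ℕ) {low m : Store} (hlow : ∀ i < lowWidth, low i < 2 ^ b)
    (hj : j ≤ w₀) (hm : ∀ i, j ≤ i → m i = 0) (hs : m.bits w₀ ≤ s) :
    Runs w (s + lowWidth * b) (Prog.clear j) (low.embed m) (low.embed fun _ => 0) := by
  have hb : ∀ m : Store, (∀ i, w₀ ≤ i → m i = 0) → m.bits w₀ ≤ s →
      (low.embed m).bits w ≤ s + lowWidth * b := fun m hm hs =>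
    (Store.bits_embed_le w hlow hm).trans (by omega)
  induction j generalizing m with
  | zero =>
    have : m = fun _ => 0 := funext fun i => hm i (Nat.zero_le _)
    subst this
    exact .skip _ (hb _ (by simp) hs)
  | succ j ih =>
    have hm' : ∀ i, j ≤ i → Function.update m j 0 i = 0 := by
      intro i hi
      rcases hi.eq_or_lt with rfl | h
      · simp
      · rw [Function.update_of_ne h.ne', hm i h]
    have hs' : Store.bits w₀ (Function.update m j 0) ≤ s := by
      refine (Store.bits_mono _ fun i => ?_).trans hs
      by_cases h : i = j
      · subst h; simp
      · rw [Function.update_of_ne h]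
    refine .seq _ _ _ (low.embed (Function.update m j 0)) _ ?_ (ih (by omega) hm' hs')
    rw [← Store.update_embed_high]
    refine .const _ _ _ (hb _ (fun i hi => hm i (hj.trans hi)) hs) ?_
    rw [Store.update_embed_high]
    exact hb _ (fun i hi => hm' i (by omega)) hs'

/-! ## Total correctness with space bounds -/

/-- The reserved registers hold at most `b` bits each, and the others hold `0`. -/
def Store.Tame (b : ℕ) (m : Store) : Prop :=
  (∀ i < lowWidth, m i < 2 ^ b) ∧ ∀ i, lowWidth ≤ i → m i = 0

/-- Started on the tame store `m`, the program halts on a tame store in `Q`, within space `s`. -/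
def WP (s b : ℕ) (p : Prog) (Q : Store → Prop) (m : Store) : Prop :=
  m.Tame b → ∃ m' : Store, m'.Tame b ∧ (∀ w, Runs w s p m m') ∧ Q m'

theorem Store.Tame.eq_embed {b : ℕ} {m : Store} (h : m.Tame b) : m = m.embed fun _ => 0 := by
  funext i
  by_cases hi : i < lowWidth
  · rw [Store.embed_low _ _ hi]
  · simp [Store.embed, hi, h.2 i (not_lt.mp hi)]

theorem Store.Tame.bits_le {b : ℕ} {m : Store} (h : m.Tame b) (w : ℕ) :
    m.bits w ≤ lowWidth * b := by
  rw [h.eq_embed]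
  exact (Store.bits_embed_le (w₀ := 0) w h.1 (by simp)).trans (by simp [Store.bits])

theorem Store.Tame.update {b : ℕ} {m : Store} (h : m.Tame b) {i v : ℕ} (hi : i < lowWidth)
    (hv : v < 2 ^ b) : Store.Tame b (Function.update m i v) := by
  refine ⟨fun j hj => ?_, fun j hj => ?_⟩
  · by_cases e : j = i
    · subst e; simpa
    · rw [Function.update_of_ne e]; exact h.1 j hj
  · rw [Function.update_of_ne (by omega)]; exact h.2 j hj

theorem Prog.ComputesInSpace.mono {s s' : ℕ} {p : Prog} {inputs : List ℕ} {out : ℕ}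
    (h : p.ComputesInSpace s inputs out) (hs : s ≤ s') : p.ComputesInSpace s' inputs out :=
  let ⟨m, hr, ho⟩ := h
  ⟨m, hr.mono_space hs, ho⟩

/-- `WP` provides runs for every width, in particular for the one that `Prog.ComputesInSpace`
prescribes. The output is read off from the final store, so it need not be known in advance. -/
theorem Prog.exists_computesInSpace_of_wp {s b : ℕ} {p : Prog} {inputs : List ℕ}
    {Q : Store → Prop} (hlen : inputs.length ≤ lowWidth) (hin : ∀ x ∈ inputs, x < 2 ^ b)
    (h : WP s b p Q (fun i => inputs.getD i 0)) :
    ∃ m, Q m ∧ p.ComputesInSpace s inputs (m 0) := by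
  obtain ⟨m', -, hr, ho⟩ := h ⟨fun i _ => by
      by_cases hi : i < inputs.length
      · simpa [List.getD_eq_getElem?_getD, hi] using hin _ (List.getElem_mem hi)
      · simp [List.getD_eq_getElem?_getD, List.getElem?_eq_none (not_lt.mp hi)], fun i hi => by
      simp [List.getD_eq_getElem?_getD, List.getElem?_eq_none (hlen.trans hi)]⟩
  exact ⟨m', ho, m', hr _, rfl⟩

theorem Prog.ComputesInSpace.of_wp {s b : ℕ} {p : Prog} {inputs : List ℕ} {out : ℕ}
    (hlen : inputs.length ≤ lowWidth) (hin : ∀ x ∈ inputs, x < 2 ^ b)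
    (h : WP s b p (fun m => m 0 = out) (fun i => inputs.getD i 0)) :
    p.ComputesInSpace s inputs out := by
  obtain ⟨m, rfl, hm⟩ := Prog.exists_computesInSpace_of_wp hlen hin h
  exact hm

/-- The inputs of a computation are part of its space. -/
theorem Prog.ComputesInSpace.lt_two_pow {s : ℕ} {p : Prog} {inputs : List ℕ} {out : ℕ}
    (h : p.ComputesInSpace s inputs out) : ∀ x ∈ inputs, x < 2 ^ s := by
  intro x hx
  obtain ⟨m, hr, -⟩ := h
  obtain ⟨i, hi, rfl⟩ := List.getElem_of_mem hx
  have := (Store.size_le_bits (w := max p.width inputs.length) (fun i => inputs.getD i 0)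
    (i := i) (by omega)).trans hr.bits_le.1
  rw [Nat.size_le] at this
  simpa [List.getD_eq_getElem?_getD, hi] using this

/-! ### Proof rules for the instructions and for subroutine calls -/

section Rules

variable {s b : ℕ} {Q : Store → Prop} {m : Store}

theorem WP.mono {p : Prog} {Q' : Store → Prop} (h : WP s b p Q' m)
    (hQ : ∀ m', Q' m' → Q m') : WP s b p Q m := fun hm =>
  let ⟨m', h₁, h₂, h₃⟩ := h hm
  ⟨m', h₁, h₂, hQ _ h₃⟩

theorem WP.skip (hs : lowWidth * b ≤ s) (h : Q m) : WP s b .skip Q m := fun hm =>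
  ⟨m, hm, fun w => .skip _ ((hm.bits_le w).trans hs), h⟩

theorem WP.const (hs : lowWidth * b ≤ s) {i c : ℕ} (hi : i < lowWidth) (hc : c < 2 ^ b)
    (h : Q (Function.update m i c)) : WP s b (.const i c) Q m := fun hm =>
  ⟨_, hm.update hi hc, fun w => .const _ _ _ ((hm.bits_le w).trans hs)
    (((hm.update hi hc).bits_le w).trans hs), h⟩

theorem WP.arith (hs : lowWidth * b ≤ s) {o : ArithOp} {i x y : ℕ} (hi : i < lowWidth)
    (hc : o.eval (m x) (m y) < 2 ^ b)
    (h : Q (Function.update m i (o.eval (m x) (m y)))) : WP s b (.arith o i x y) Q m := fun hm =>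
  ⟨_, hm.update hi hc, fun w => .arith _ _ _ _ _ ((hm.bits_le w).trans hs)
    (((hm.update hi hc).bits_le w).trans hs), h⟩

theorem WP.of_tame {p : Prog} (h : m.Tame b → WP s b p Q m) : WP s b p Q m := fun hm => h hm hm

/-- The result never exceeds the first operand, which tameness already bounds; so, unlike for sums
and products, no size condition is needed. The same holds for division and remainder. -/
theorem WP.sub (hs : lowWidth * b ≤ s) {i x y : ℕ} (hi : i < lowWidth) (hx : x < lowWidth)
    (h : Q (Function.update m i (m x - m y))) : WP s b (.arith .sub i x y) Q m :=
  .of_tame fun hm => .arith hs hi ((Nat.sub_le _ _).trans_lt (hm.1 x hx)) h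

theorem WP.div (hs : lowWidth * b ≤ s) {i x y : ℕ} (hi : i < lowWidth) (hx : x < lowWidth)
    (h : Q (Function.update m i (m x / m y))) : WP s b (.arith .div i x y) Q m :=
  .of_tame fun hm => .arith hs hi ((Nat.div_le_self _ _).trans_lt (hm.1 x hx)) h

theorem WP.mod (hs : lowWidth * b ≤ s) {i x y : ℕ} (hi : i < lowWidth) (hx : x < lowWidth)
    (h : Q (Function.update m i (m x % m y))) : WP s b (.arith .mod i x y) Q m :=
  .of_tame fun hm => .arith hs hi ((Nat.mod_le _ _).trans_lt (hm.1 x hx)) h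

theorem WP.add (hs : lowWidth * b ≤ s) {i x y : ℕ} (hi : i < lowWidth) (hc : m x + m y < 2 ^ b)
    (h : Q (Function.update m i (m x + m y))) : WP s b (.arith .add i x y) Q m :=
  .arith hs hi hc h

theorem WP.mul (hs : lowWidth * b ≤ s) {i x y : ℕ} (hi : i < lowWidth) (hc : m x * m y < 2 ^ b)
    (h : Q (Function.update m i (m x * m y))) : WP s b (.arith .mul i x y) Q m :=
  .arith hs hi hc h

theorem WP.seq {p q : Prog} (h : WP s b p (WP s b q Q) m) : WP s b (.seq p q) Q m := fun hm =>
  let ⟨_, hm₁, hr, h₁⟩ := h hm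
  let ⟨m₂, hm₂, hr', h₂⟩ := h₁ hm₁
  ⟨m₂, hm₂, fun w => .seq _ _ _ _ _ (hr w) (hr' w), h₂⟩

theorem WP.branch {i : ℕ} {p q : Prog} (hp : m i ≠ 0 → WP s b p Q m)
    (hq : m i = 0 → WP s b q Q m) : WP s b (.branch i p q) Q m := fun hm => by
  by_cases hi : m i = 0
  · obtain ⟨m', h₁, h₂, h₃⟩ := hq hi hm
    exact ⟨m', h₁, fun w => .branch_else _ _ _ _ _ hi (h₂ w), h₃⟩
  · obtain ⟨m', h₁, h₂, h₃⟩ := hp hi hm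
    exact ⟨m', h₁, fun w => .branch_then _ _ _ _ _ hi (h₂ w), h₃⟩

theorem WP.loop_done (hs : lowWidth * b ≤ s) {i : ℕ} {p : Prog} (hi : m i = 0) (h : Q m) :
    WP s b (.loop i p) Q m := fun hm =>
  ⟨m, hm, fun w => .loop_done _ _ _ hi ((hm.bits_le w).trans hs), h⟩

theorem WP.loop_step {i : ℕ} {p : Prog} (hi : m i ≠ 0) (h : WP s b p (WP s b (.loop i p) Q) m) :
    WP s b (.loop i p) Q m := fun hm =>
  let ⟨_, hm₁, hr, h₁⟩ := h hm
  let ⟨m₂, hm₂, hr', h₂⟩ := h₁ hm₁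
  ⟨m₂, hm₂, fun w => .loop_step _ _ _ _ _ hi (hr w) (hr' w), h₂⟩

/-- A loop that decreases the register `i`. -/
theorem WP.loop_variant (hs : lowWidth * b ≤ s) {i : ℕ} {p : Prog} (I : Store → Prop)
    (hstep : ∀ m, I m → m i ≠ 0 → WP s b p (fun m' => I m' ∧ m' i < m i) m)
    (hQ : ∀ m, I m → m i = 0 → Q m) (hm : I m) : WP s b (.loop i p) Q m := by
  obtain ⟨k, hk⟩ : ∃ k, m i = k := ⟨_, rfl⟩
  induction k using Nat.strong_induction_on generalizing m with
  | _ k ih =>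
    by_cases h0 : m i = 0
    · exact .loop_done hs h0 (hQ m hm h0)
    · exact .loop_step h0 ((hstep m hm h0).mono fun m' h => ih _ (hk ▸ h.2) h.1 rfl)

/-- A loop that decreases the register `i` by `1` each time. -/
theorem WP.loop_count (hs : lowWidth * b ≤ s) {i : ℕ} {p : Prog} (I : Store → Prop)
    (hstep : ∀ m k, I m → m i = k + 1 → WP s b p (fun m' => I m' ∧ m' i = k) m)
    (hQ : ∀ m, I m → m i = 0 → Q m) (hm : I m) : WP s b (.loop i p) Q m := by
  refine .loop_variant hs I (fun m hI hi => ?_) hQ hm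
  obtain ⟨k, hk⟩ := Nat.exists_eq_succ_of_ne_zero hi
  exact (hstep m k hI hk).mono fun m' h => ⟨h.1, by omega⟩

/-- Copy register `x` to register `i`. -/
def Prog.copy (i x : ℕ) : Prog := .seq (.const i 0) (.arith .add i x i)

theorem WP.copy (hs : lowWidth * b ≤ s) {i x : ℕ} (hi : i < lowWidth) (hx : x < lowWidth)
    (hne : x ≠ i) (h : Q (Function.update m i (m x))) : WP s b (Prog.copy i x) Q m :=
  .of_tame fun hm => by
    have e : Function.update m i 0 x + Function.update m i 0 i = m x := by simp [hne]
    refine .seq (.const hs hi (by positivity) (.add hs hi ?_ ?_)) <;> rw [e]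
    · exact hm.1 x hx
    · simpa using h

/-- The called program sees only the upper registers, while the lower ones stay within `lowWidth *
b` bits; the two costs add up to `s₀ + lowWidth * b`. The final clearing makes the store tame again,
so calls can be repeated at no further cost. -/
theorem WP.call {s₀ : ℕ} (hs : s₀ + lowWidth * b ≤ s) {p : Prog} {args : List ℕ} {o out : ℕ}
    (hp : p.ComputesInSpace s₀ (args.map m) out) (hargs : ∀ a ∈ args, a < lowWidth)
    (ho : o < lowWidth) (hout : out < 2 ^ b) (h : Q (Function.update m o out)) :
    WP s b (p.call args o) Q m := fun hm => by
  obtain ⟨m₁, hr, rfl⟩ := hp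
  have mono := fun {w p m m'} (h : Runs w (s₀ + lowWidth * b) p m m') => h.mono_space hs
  rw [List.length_map] at hr
  have hm0 : ∀ i, max p.width args.length ≤ i → (args.map m).getD i 0 = 0 := fun i hi => by
    rw [List.getD_eq_getElem?_getD, List.getElem?_eq_none (by simp; omega)]; rfl
  have hm₁ := (hr.embed (le_max_left _ _) hm0 0 hm.1).2
  have hm' := hm.update ho hout
  refine ⟨_, hm', fun w => mono ?_, h⟩
  have r₁ := runs_setArgs (s := s₀) w hm.1 args hargs [] (w₀ := max p.width args.length)
    (by simp) (by simpa using hr.bits_le.1)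
  -- A tame store is the embedded store with an empty argument list, which is where the copying
  -- starts.
  have e₀ : (m.embed fun i => ([] : List ℕ).getD i 0) = m := by
    conv_rhs => rw [hm.eq_embed]
    simp
  rw [e₀] at r₁
  have hb : ∀ low : Store, (∀ i < lowWidth, low i < 2 ^ b) →
      (low.embed m₁).bits w ≤ s₀ + lowWidth * b := fun low hlow =>
    (Store.bits_embed_le w hlow hm₁).trans (Nat.add_le_add_right hr.bits_le.2 _)
  have hz := hm.update (v := 0) ho (by positivity)
  refine .seq _ _ _ _ _ r₁ (.seq _ _ _ _ _ (hr.embed (le_max_left _ _) hm0 w hm.1).1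
    (.seq _ _ _ (Store.embed (Function.update m o (m₁ 0)) m₁) _
      (.seq _ _ _ (Store.embed (Function.update m o 0) m₁) _ ?_ ?_) ?_))
  · rw [← Store.update_embed_low _ _ _ ho]
    refine .const _ _ _ (hb _ hm.1) ?_
    rw [Store.update_embed_low _ _ _ ho]
    exact hb _ hz.1
  · have e : Function.update (Store.embed (Function.update m o 0) m₁) o (ArithOp.eval .add
        (Store.embed (Function.update m o 0) m₁ (lowWidth + 0))
        (Store.embed (Function.update m o 0) m₁ o)) =
        Store.embed (Function.update m o (m₁ 0)) m₁ := by
      rw [Store.embed_high, Store.embed_low _ _ ho, Store.update_embed_low _ _ _ ho]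
      simp [ArithOp.eval]
    rw [← e]
    refine .arith _ _ _ _ _ (hb _ hz.1) ?_
    rw [e]
    exact hb _ hm'.1
  · conv_rhs => rw [hm'.eq_embed]
    exact runs_clear w _ hm'.1 le_rfl hm₁ hr.bits_le.2

/-- Run the programs in the list one after the other. -/
def Prog.block : List Prog → Prog
  | [] => .skip
  | p :: l => .seq p (Prog.block l)

theorem WP.block_nil (hs : lowWidth * b ≤ s) (h : Q m) : WP s b (Prog.block []) Q m :=
  .skip hs h

theorem WP.block_cons {p : Prog} {l : List Prog} (h : WP s b p (WP s b (Prog.block l) Q) m) :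
    WP s b (Prog.block (p :: l)) Q m := .seq h

end Rules

/-! ## Reachability in small space -/

/-- `y` can be reached from `x` in `t + 1` steps along the relation `r`. -/
def ReachSucc {α : Type*} (r : α → α → Prop) : ℕ → α → α → Prop
  | 0, x, y => r x y
  | t + 1, x, y => ∃ w, r x w ∧ ReachSucc r t w y

/-- The index is the number of steps minus one, so `(s + 1) + (t + 1)` steps have index `s + t + 1`.
-/
theorem reachSucc_add {α : Type*} (r : α → α → Prop) (s t : ℕ) (x y : α) :
    ReachSucc r (s + t + 1) x y ↔ ∃ w, ReachSucc r s x w ∧ ReachSucc r t w y := by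
  induction s generalizing x with
  | zero => simp [ReachSucc]
  | succ s ih =>
    rw [show s + 1 + t + 1 = (s + t + 1) + 1 by omega]
    change (∃ w, r x w ∧ ReachSucc r (s + t + 1) w y) ↔
      ∃ w, (∃ v, r x v ∧ ReachSucc r s v w) ∧ ReachSucc r t w y
    simp only [ih]
    constructor
    · rintro ⟨w, h, v, h₁, h₂⟩; exact ⟨v, ⟨w, h, h₁⟩, h₂⟩
    · rintro ⟨v, ⟨w, h, h₁⟩, h₂⟩; exact ⟨w, h, v, h₁, h₂⟩

theorem ReachSucc.preserves {α : Type*} {r : α → α → Prop} {V : α → Prop}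
    (hr : ∀ x y, V x → r x y → V y) {t : ℕ} {x y : α} (hx : V x) (h : ReachSucc r t x y) :
    V y := by
  induction t generalizing x with
  | zero => exact hr _ _ hx h
  | succ t ih => obtain ⟨w, hw, h⟩ := h; exact ih (hr _ _ hx hw) h

/-- One letter below `S`, read in both components of an encoded pair of states. -/
def PairStep (upd : ℕ → ℕ → ℕ) (S B x y : ℕ) : Prop :=
  ∃ a < S, upd (x / B) a * B + upd (x % B) a = y

/-- `x` encodes a pair of numbers below `card`. -/
def ValidPair (card B x : ℕ) : Prop := x / B < card ∧ x % B < card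

/-- Clear register 25 if and only if registers 25 and 26 hold the components of the pair in
register 16. -/
def Prog.comparePair : Prog := .block [
  .arith .mul 25 25 7, .arith .add 25 25 26, .arith .sub 26 25 16, .arith .sub 25 16 25,
  .arith .add 25 25 26]

/-- Decide whether the pair in register 16 is one letter away from the pair in register 15. -/
def Prog.pairStep (pσ : Prog) : Prog := .block [
  .arith .div 22 15 7, .arith .mod 23 15 7, .const 20 0, .copy 24 1,
  .loop 24 (.block [
    .arith .sub 24 24 30,
    .call pσ [0, 1, 2, 3, 22, 24] 25,
    .call pσ [0, 1, 2, 3, 23, 24] 26,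
    .comparePair,
    .branch 25 .skip (.const 20 1)])]

/-- Put the content of register `v` on the stack in register 17, whose base is in register 8. -/
def Prog.push (v : ℕ) : Prog := .block [.arith .mul 17 17 8, .arith .add 17 17 v]

/-- Move the top of the stack in register 17 to register `v`. -/
def Prog.pop (v : ℕ) : Prog := .block [.arith .mod v 17 8, .arith .div 17 17 8]

/-- Put a frame on the stack. -/
def Prog.pushFrame : Prog := .block [.push 14, .push 15, .push 16, .push 18, .push 19]

/-- Take a frame off the stack. -/
def Prog.popFrame : Prog := .block [.pop 19, .pop 18, .pop 16, .pop 15, .pop 14]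

/-- One step of the recursive search for a path with `t + 1` steps between the pairs in registers 15
and 16, where `t` is in register 14. Register 13 tells a call from a return, register 20
holds the returned value, and register 21 is cleared when the search is over. In a frame, registers
18 and 19 hold the midpoint and the half of the path. -/
def Prog.savitchStep (pσ : Prog) : Prog :=
  .branch 13
    (.branch 14
      (.block [.arith .sub 18 8 30, .const 19 0, .pushFrame, .const 20 0, .const 13 0])
      (.block [.pairStep pσ, .const 13 0]))
    (.branch 17
      (.block [.popFrame,
        .branch 20
          (.branch 19 .skip
            (.block [.const 19 1, .pushFrame, .arith .sub 14 14 30, .arith .div 14 14 31,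
              .copy 15 18, .const 13 1]))
          (.branch 18
            (.block [.arith .sub 18 18 30, .const 19 0, .pushFrame, .arith .div 14 14 31,
              .copy 16 18, .const 13 1])
            .skip)])
      (.const 21 0))

/-- Decide whether there is a path with `t + 1` steps between the pairs in registers 15 and 16,
where `t` is in register 14. -/
def Prog.savitch (pσ : Prog) : Prog :=
  .block [.const 17 0, .const 13 1, .const 21 1, .loop 21 (.savitchStep pσ)]

/-- The stack `K` with one more frame. -/
def pushFrame (D t x y w h K : ℕ) : ℕ := ((((K * D + t) * D + x) * D + y) * D + w) * D + h

theorem mul_add_lt_pow_succ {D K e v : ℕ} (hK : K < D ^ e) (hv : v < D) :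
    K * D + v < D ^ (e + 1) := by
  rw [pow_succ]; nlinarith

theorem pushFrame_lt {D K e t x y w h : ℕ} (hK : K < D ^ e) (ht : t < D) (hx : x < D) (hy : y < D)
    (hw : w < D) (hh : h < D) : pushFrame D t x y w h K < D ^ (e + 5) := by
  unfold pushFrame
  exact mul_add_lt_pow_succ (mul_add_lt_pow_succ (mul_add_lt_pow_succ (mul_add_lt_pow_succ
    (mul_add_lt_pow_succ hK ht) hx) hy) hw) hh

/-- Only calls with `t ≠ 0` create frames. A nonempty stack is therefore a nonzero number, and `0`
can mark the empty stack. -/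
theorem pushFrame_pos {D K t x y w h : ℕ} (hD : 0 < D) (ht : t ≠ 0) :
    pushFrame D t x y w h K ≠ 0 := by
  unfold pushFrame
  positivity

/-! ### Comparing pairs, and the stack packed into one number -/

section

variable {s b : ℕ} {Q : Store → Prop} {m : Store}

/-- With truncated subtraction, `u - v` and `v - u` both vanish only if `u = v`, so their sum tests
equality. -/
theorem WP.comparePair (hs : lowWidth * b ≤ s) (hb : m 25 * m 7 + m 26 < 2 ^ b)
    (hQ : ∀ m' : Store, (∀ i, i ≠ 25 → i ≠ 26 → m' i = m i) →
      (m' 25 = 0 ↔ m 25 * m 7 + m 26 = m 16) → Q m') :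
    WP s b .comparePair Q m := by
  refine .of_tame fun tame => ?_
  have h16 := tame.1 16 (by decide)
  refine .block_cons <| .mul hs (by decide) (by omega) <| .block_cons <| .add hs (by decide) ?_ <|
    .block_cons <| .sub hs (by decide) (by decide) <| .block_cons <| .sub hs (by decide) (by decide)
    <| .block_cons <| .add hs (by decide) ?_ <| .block_nil hs <| hQ _ (fun i _ _ => ?_) ?_
  · simpa using hb
  · simp; omega
  · simp (disch := omega) only [Function.update_of_ne]
  · simp; omega

theorem WP.push (hs : lowWidth * b ≤ s) {v : ℕ} (hne : v ≠ 17)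
    (hb : m 17 * m 8 + m v < 2 ^ b) (h : Q (Function.update m 17 (m 17 * m 8 + m v))) :
    WP s b (.push v) Q m := by
  refine .block_cons (.mul hs (by decide) (by omega) (.block_cons (.add hs (by decide) ?_
    (.block_nil hs ?_)))) <;> simpa [hne]

theorem WP.pop (hs : lowWidth * b ≤ s) {v : ℕ} (hv : v < lowWidth) (hne : v ≠ 17) (hne' : v ≠ 8)
    (h : Q (Function.update (Function.update m v (m 17 % m 8)) 17 (m 17 / m 8))) :
    WP s b (.pop v) Q m := by
  refine .block_cons (.mod hs hv (by decide) (.block_cons (.div hs (by decide) (by decide)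
    (.block_nil hs ?_))))
  simpa [hne.symm, hne'.symm] using h

theorem WP.pushFrame (hs : lowWidth * b ≤ s) {D t x y w h K : ℕ} (hD : m 8 = D) (ht : m 14 = t)
    (hx : m 15 = x) (hy : m 16 = y) (hw : m 18 = w) (hh : m 19 = h) (hK : m 17 = K) (hD0 : 0 < D)
    (hb : pushFrame D t x y w h K < 2 ^ b)
    (hQ : Q (Function.update m 17 (pushFrame D t x y w h K))) :
    WP s b .pushFrame Q m := by
  unfold _root_.pushFrame at hb
  have le : ∀ u v : ℕ, u ≤ u * D + v := fun u v =>
    (Nat.le_mul_of_pos_right u hD0).trans (Nat.le_add_right _ _)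
  have b₄ := (le _ h).trans_lt hb
  have b₃ := (le _ w).trans_lt b₄
  have b₂ := (le _ y).trans_lt b₃
  have b₁ := (le _ x).trans_lt b₂
  refine .block_cons (.push hs (by decide) ?_ (.block_cons (.push hs (by decide) ?_
    (.block_cons (.push hs (by decide) ?_ (.block_cons (.push hs (by decide) ?_
    (.block_cons (.push hs (by decide) ?_ (.block_nil hs ?_))))))))))
  all_goals simp [hD, ht, hx, hy, hw, hh, hK]
  all_goals assumption

theorem WP.popFrame (hs : lowWidth * b ≤ s) {D t x y w h K : ℕ} (hD : m 8 = D)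
    (hK : m 17 = _root_.pushFrame D t x y w h K) (ht : t < D) (hx : x < D) (hy : y < D)
    (hw : w < D) (hh : h < D)
    (hQ : ∀ m' : Store, (∀ i, i < 14 ∨ 19 < i → m' i = m i) → m' 14 = t → m' 15 = x → m' 16 = y →
      m' 17 = K → m' 18 = w → m' 19 = h → Q m') :
    WP s b .popFrame Q m := by
  have hm : ∀ u v : ℕ, v < D → (u * D + v) % D = v := fun u v hv => by
    rw [mul_comm, Nat.mul_add_mod, Nat.mod_eq_of_lt hv]
  have hd : ∀ u v : ℕ, v < D → (u * D + v) / D = u := fun u v hv => by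
    rw [mul_comm, Nat.mul_add_div (by omega), Nat.div_eq_of_lt hv, add_zero]
  refine .block_cons (.pop hs (by decide) (by decide) (by decide) (.block_cons (.pop hs (by decide)
    (by decide) (by decide) (.block_cons (.pop hs (by decide) (by decide) (by decide) (.block_cons
    (.pop hs (by decide) (by decide) (by decide) (.block_cons (.pop hs (by decide) (by decide)
    (by decide) (.block_nil hs (hQ _ ?_ ?_ ?_ ?_ ?_ ?_ ?_)))))))))))
  · intro i hi
    simp (disch := omega) only [Function.update_of_ne]
  all_goals simp [_root_.pushFrame, *]

end

/-! ### The graph of pairs of states -/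

/-- The data of a search: the transition function `upd` on the numbers below `card` and the letters
below `S`, a program for it with its parameters, a bound `B` on `card` and the base `D` of the
stack. -/
structure SearchData where
  (pσ : Prog) (upd : ℕ → ℕ → ℕ) (n S k R card B D T s b : ℕ)
  space_le : T + lowWidth * b ≤ s
  computes : ∀ q < card, ∀ a < S, pσ.ComputesInSpace T [n, S, k, R, q, a] (upd q a)
  upd_lt : ∀ q < card, ∀ a < S, upd q a < card
  card_le : card ≤ B
  sq_lt : B * B < D
  base_le : D ≤ 2 ^ b

namespace SearchData

variable (c : SearchData)

/-- The store holds the parameters of the search. -/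
structure Params (m : Store) : Prop where
  (r0 : m 0 = c.n) (r1 : m 1 = c.S) (r2 : m 2 = c.k) (r3 : m 3 = c.R) (r7 : m 7 = c.B)
  (r8 : m 8 = c.D) (r30 : m 30 = 1) (r31 : m 31 = 2)

/-- One letter read in both components. -/
abbrev Step : ℕ → ℕ → Prop := PairStep c.upd c.S c.B

/-- A pair of states. -/
abbrev Valid : ℕ → Prop := ValidPair c.card c.B

variable {c}

theorem hs : lowWidth * c.b ≤ c.s := (Nat.le_add_left _ _).trans c.space_le

theorem mul_add_lt_sq {u v B : ℕ} (hu : u < B) (hv : v < B) : u * B + v < B * B := by nlinarith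

theorem Valid.lt {x : ℕ} (hx : c.Valid x) : x < c.B * c.B := by
  have hB := hx.1.trans_le c.card_le
  exact (Nat.div_lt_iff_lt_mul (Nat.zero_lt_of_lt hB)).mp hB

theorem Valid.mk {u v : ℕ} (hu : u < c.card) (hv : v < c.card) : c.Valid (u * c.B + v) := by
  have hv' := hv.trans_le c.card_le
  rw [Valid, ValidPair, mul_comm, Nat.mul_add_div (by omega), Nat.mul_add_mod,
    Nat.div_eq_of_lt hv', Nat.mod_eq_of_lt hv']
  exact ⟨by simpa, hv⟩

theorem Valid.step {x y : ℕ} (hx : c.Valid x) (h : c.Step x y) : c.Valid y := by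
  obtain ⟨a, ha, rfl⟩ := h
  exact .mk (c.upd_lt _ hx.1 _ ha) (c.upd_lt _ hx.2 _ ha)

-- The letters are tried from `S - 1` down to `0`. The loop invariant says that register 20 is `1`
-- exactly if some letter not below the counter in register 24 works.
open Classical in
theorem wp_pairStep {m : Store} {Q : Store → Prop} (hm : c.Params m) (hx : c.Valid (m 15))
    (hQ : ∀ m' : Store, (∀ i, i ≠ 20 → i < 22 ∨ 26 < i → m' i = m i) →
      m' 20 = (if c.Step (m 15) (m 16) then 1 else 0) → Q m') :
    WP c.s c.b (.pairStep c.pσ) Q m := by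
  have hs := c.hs
  have hB : c.B * c.B < 2 ^ c.b := c.sq_lt.trans_le c.base_le
  have hb0 : 1 < 2 ^ c.b := by
    have := Nat.zero_lt_of_lt (hx.1.trans_le c.card_le)
    have := Nat.mul_pos this this
    omega
  refine .block_cons <| .div hs (by decide) (by decide) <| .block_cons <| .mod hs (by decide)
    (by decide) <| .block_cons <| .const hs (by decide) (by positivity) <| .block_cons <|
    .copy hs (by decide) (by decide) (by decide) <| .block_cons <| (.loop_count hs (fun m' =>
      (∀ i, i ≠ 20 → i < 22 ∨ 26 < i → m' i = m i) ∧ m' 22 = m 15 / c.B ∧ m' 23 = m 15 % c.B ∧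
      m' 24 ≤ c.S ∧ m' 20 = if ∃ a < c.S, m' 24 ≤ a ∧
        c.upd (m 15 / c.B) a * c.B + c.upd (m 15 % c.B) a = m 16 then 1 else 0)
      ?_ ?_ ?_)
  · rintro m₁ a ⟨hI, h22, h23, h24, h20⟩ ha
    rw [ha] at h24 h20
    have haS : a < c.S := h24
    have h1 := c.upd_lt _ hx.1 _ haS
    have h2 := c.upd_lt _ hx.2 _ haS
    have h1' := h1.trans_le c.card_le
    have h2' := h2.trans_le c.card_le
    have h3 := mul_add_lt_sq h1' h2'
    have p0 := (hI 0 (by decide) (by decide)).trans hm.r0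
    have p1 := (hI 1 (by decide) (by decide)).trans hm.r1
    have p2 := (hI 2 (by decide) (by decide)).trans hm.r2
    have p3 := (hI 3 (by decide) (by decide)).trans hm.r3
    have p7 := (hI 7 (by decide) (by decide)).trans hm.r7
    have p16 := hI 16 (by decide) (by decide)
    have p30 := (hI 30 (by decide) (by decide)).trans hm.r30
    have b1 : c.upd (m 15 / c.B) a < 2 ^ c.b := by nlinarith
    have b2 : c.upd (m 15 % c.B) a < 2 ^ c.b := by nlinarith
    refine .block_cons <| .sub hs (by decide) (by decide) <| .block_cons <| .call c.space_le
      (out := c.upd (m 15 / c.B) a) ?_ (by decide) (by decide) b1 <| .block_cons <|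
      .call c.space_le (out := c.upd (m 15 % c.B) a) ?_ (by decide) (by decide) b2 <|
      .block_cons <| .comparePair hs ?_ fun m₂ hm₂ h25 => .block_cons <|
      .branch (fun h => .skip hs (.block_nil hs ?_)) fun h => .const hs (by decide) hb0
        (.block_nil hs ?_)
    · simpa [p0, p1, p2, p3, p30, ha, h22] using c.computes _ hx.1 _ haS
    · simpa [p0, p1, p2, p3, p30, ha, h23] using c.computes _ hx.2 _ haS
    · simp [p7]; omega
    all_goals
      simp [p7, p16] at h25
      have h24' : m₂ 24 = a := by rw [hm₂ _ (by decide) (by decide)]; simp [ha, p30]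
      refine ⟨⟨fun i hi hi' => ?_, ?_, ?_, ?_, ?_⟩, ?_⟩
      · simp (disch := omega) only [Function.update_of_ne, hm₂]
        exact hI i hi hi'
      · simpa [hm₂] using h22
      · simpa [hm₂] using h23
      · simp [h24']; omega
      rotate_left
      · simp [h24']
    · have hne : c.upd (m 15 / c.B) a * c.B + c.upd (m 15 % c.B) a ≠ m 16 := fun e =>
        h (h25.mpr e)
      rw [h24', hm₂ 20 (by decide) (by decide), Function.update_of_ne (by decide),
        Function.update_of_ne (by decide), Function.update_of_ne (by decide), h20]
      refine if_congr ⟨?_, ?_⟩ rfl rfl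
      · rintro ⟨a', h₁, h₂, h₃⟩; exact ⟨a', h₁, by omega, h₃⟩
      · rintro ⟨a', h₁, h₂, h₃⟩
        refine ⟨a', h₁, ?_, h₃⟩
        rcases h₂.eq_or_lt with rfl | h
        · exact (hne h₃).elim
        · exact h
    · rw [Function.update_self, if_pos]
      exact ⟨a, haS, by simp [h24'], h25.mp h⟩
  · rintro m₁ ⟨hI, h22, h23, h24, h20⟩ ha
    refine .block_nil hs (hQ _ hI ?_)
    exact h20.trans (if_congr (by simp [ha, PairStep]) rfl rfl)
  · refine ⟨fun i hi hi' => ?_, ?_, ?_, ?_, ?_⟩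
    · simp (disch := omega) only [Function.update_of_ne]
    · simp [hm.r7]
    · simp [hm.r7]
    · simp [hm.r1]
    · have : ¬ ∃ a < c.S, m 1 ≤ a ∧
          c.upd (m 15 / c.B) a * c.B + c.upd (m 15 % c.B) a = m 16 := by
        rintro ⟨a, h₁, h₂, -⟩
        rw [hm.r1] at h₂
        omega
      simpa using this

/-! ### The recursive search -/

/-- Outside the registers of the search, the store agrees with `m₀`. -/
def Agrees (m₀ m : Store) : Prop := ∀ i, i < 13 ∨ 26 < i → m i = m₀ i

theorem Agrees.params {m₀ m : Store} (h₀ : c.Params m₀) (h : Agrees m₀ m) : c.Params m :=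
  ⟨(h 0 (by decide)).trans h₀.r0, (h 1 (by decide)).trans h₀.r1, (h 2 (by decide)).trans h₀.r2,
    (h 3 (by decide)).trans h₀.r3, (h 7 (by decide)).trans h₀.r7, (h 8 (by decide)).trans h₀.r8,
    (h 30 (by decide)).trans h₀.r30, (h 31 (by decide)).trans h₀.r31⟩

/-- The search is about to look for a path of `t + 1` steps from `x` to `y`. -/
structure Calls (m₀ : Store) (t x y K : ℕ) (m : Store) : Prop where
  (agrees : Agrees m₀ m) (r13 : m 13 = 1) (r14 : m 14 = t) (r15 : m 15 = x) (r16 : m 16 = y)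
  (r17 : m 17 = K) (r21 : m 21 = 1)

/-- The search returns the value `r`. -/
structure Returns (m₀ : Store) (r K : ℕ) (m : Store) : Prop where
  (agrees : Agrees m₀ m) (r13 : m 13 = 0) (r20 : m 20 = r) (r17 : m 17 = K) (r21 : m 21 = 1)

section Steps

variable {m₀ m : Store} {Q : Store → Prop} {t x y w h K : ℕ}

theorem wp_call_zero (h₀ : c.Params m₀) (hx : c.Valid x) (hm : Calls m₀ 0 x y K m)
    (hQ : ∀ m', (c.Step x y → Returns m₀ 1 K m') → (¬ c.Step x y → Returns m₀ 0 K m') → Q m') :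
    WP c.s c.b (.savitchStep c.pσ) Q m := by
  have hs := c.hs
  refine .branch (fun _ => .branch (fun h => (h hm.r14).elim) fun _ => ?_)
    (fun h => by simp [hm.r13] at h)
  refine .block_cons (wp_pairStep (hm.agrees.params h₀) (hm.r15 ▸ hx) fun m' hm' h20 =>
    .block_cons (.const hs (by decide) (by positivity) (.block_nil hs ?_)))
  have key : ∀ r, m' 20 = r → Returns m₀ r K (Function.update m' 13 0) := by
    intro r hr
    refine ⟨fun i hi => ?_, ?_, ?_, ?_, ?_⟩
    · simp (disch := omega) only [Function.update_of_ne]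
      rw [hm' i (by omega) (by omega), hm.agrees i hi]
    · simp
    · simpa
    · simp [hm' 17 (by decide) (by decide), hm.r17]
    · simp [hm' 21 (by decide) (by decide), hm.r21]
  rw [hm.r15, hm.r16] at h20
  exact hQ _ (fun h => key 1 (by rw [h20, if_pos h])) (fun h => key 0 (by rw [h20, if_neg h]))

/-- The machine pretends that the candidate midpoint `D - 1` has just failed, so that the code for
the next candidate also serves to start the enumeration. Nothing is lost: `B * B < D`, so `D - 1` is
not the code of a pair of states. -/
theorem wp_call_pos (h₀ : c.Params m₀) (ht : t ≠ 0) (hm : Calls m₀ t x y K m)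
    (hb : pushFrame c.D t x y (c.D - 1) 0 K < 2 ^ c.b)
    (hQ : ∀ m', Returns m₀ 0 (pushFrame c.D t x y (c.D - 1) 0 K) m' → Q m') :
    WP c.s c.b (.savitchStep c.pσ) Q m := by
  have hs := c.hs
  have hp := hm.agrees.params h₀
  refine .branch (fun _ => .branch (fun _ => ?_) fun h => (ht (hm.r14 ▸ h)).elim)
    (fun h => by simp [hm.r13] at h)
  refine .block_cons <| .sub hs (by decide) (by decide) <| .block_cons <| .const hs (by decide)
    (by positivity) <| .block_cons <| .pushFrame hs (D := c.D) (t := t) (x := x) (y := y)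
      (w := c.D - 1) (h := 0) (K := K) ?_ ?_ ?_ ?_ ?_ ?_ ?_ (by have := c.sq_lt; omega) hb <|
    .block_cons <| .const hs (by decide) (by positivity) <| .block_cons <| .const hs (by decide)
      (by positivity) <| .block_nil hs <| hQ _ ⟨fun i hi => ?_, ?_, ?_, ?_, ?_⟩
  case refine_8 =>
    simp (disch := omega) only [Function.update_of_ne]
    exact hm.agrees i hi
  all_goals simp [hp.r8, hp.r30, hm.r14, hm.r15, hm.r16, hm.r17, hm.r21]

theorem wp_return_empty (hm : Returns m₀ h 0 m)
    (hQ : ∀ m', Agrees m₀ m' → m' 20 = h → m' 21 = 0 → Q m') :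
    WP c.s c.b (.savitchStep c.pσ) Q m := by
  refine .branch (fun h => (h hm.r13).elim) fun _ => .branch (fun h => (h hm.r17).elim) fun _ =>
    .const c.hs (by decide) (by positivity) (hQ _ (fun i hi => ?_) ?_ ?_)
  · simp (disch := omega) only [Function.update_of_ne]
    exact hm.agrees i hi
  · simp [hm.r20]
  · simp

/-- The bounds on a frame. -/
structure FrameBounds (c : SearchData) (t x y w h : ℕ) : Prop where
  (ne : t ≠ 0) (ht : t < c.D) (hx : x < c.D) (hy : y < c.D) (hw : w < c.D) (hh : h < c.D)

theorem FrameBounds.pos (hf : FrameBounds c t x y w h) : pushFrame c.D t x y w h K ≠ 0 :=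
  pushFrame_pos (Nat.zero_lt_of_lt hf.ht) hf.ne

theorem wp_return_true_second (h₀ : c.Params m₀) (hf : FrameBounds c t x y w 1)
    (hm : Returns m₀ 1 (pushFrame c.D t x y w 1 K) m)
    (hQ : ∀ m', Returns m₀ 1 K m' → Q m') :
    WP c.s c.b (.savitchStep c.pσ) Q m := by
  have hs := c.hs
  have hp := hm.agrees.params h₀
  refine .branch (fun h => (h hm.r13).elim) fun _ => .branch (fun _ => ?_)
    fun h => (hf.pos (hm.r17 ▸ h)).elim
  refine .block_cons (.popFrame hs hp.r8 hm.r17 hf.ht hf.hx hf.hy hf.hw hf.hh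
    fun m' hm' h14 h15 h16 h17 h18 h19 => .block_cons (.branch
      (fun _ => .branch (fun _ => .skip hs (.block_nil hs (hQ _ ⟨fun i hi => ?_, ?_, ?_, ?_, ?_⟩)))
        fun h => by simp [h19] at h) fun h => ?_))
  · rw [hm' i (by omega), hm.agrees i hi]
  · rw [hm' _ (by omega), hm.r13]
  · rw [hm' _ (by omega), hm.r20]
  · exact h17
  · rw [hm' _ (by omega), hm.r21]
  · simp [hm' 20 (by omega), hm.r20] at h

/-- Half `0` of the path has been found up to the midpoint `w`. The frame goes back on the stack
with its flag set to `1`, and the search continues from `w` to `y`. -/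
theorem wp_return_true_first (h₀ : c.Params m₀) (hf : FrameBounds c t x y w 0)
    (hm : Returns m₀ 1 (pushFrame c.D t x y w 0 K) m)
    (hb : pushFrame c.D t x y w 1 K < 2 ^ c.b)
    (hQ : ∀ m', Calls m₀ ((t - 1) / 2) w y (pushFrame c.D t x y w 1 K) m' → Q m') :
    WP c.s c.b (.savitchStep c.pσ) Q m := by
  have hs := c.hs
  have hp := hm.agrees.params h₀
  have hb1 : 1 < 2 ^ c.b := lt_of_le_of_lt (by have := hf.pos (K := K); unfold pushFrame; omega) hb
  refine .branch (fun h => (h hm.r13).elim) fun _ => .branch (fun _ => ?_)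
    fun h => (hf.pos (hm.r17 ▸ h)).elim
  refine .block_cons (.popFrame hs hp.r8 hm.r17 hf.ht hf.hx hf.hy hf.hw hf.hh
    fun m' hm' h14 h15 h16 h17 h18 h19 => .block_cons (.branch
      (fun _ => .branch (fun h => (h h19).elim) fun _ => ?_) fun h => ?_))
  · refine .block_cons <| .const hs (by decide) hb1 <| .block_cons <| .pushFrame hs (D := c.D)
      (t := t) (x := x) (y := y) (w := w) (h := 1) (K := K) ?_ ?_ ?_ ?_ ?_ ?_ ?_
      (Nat.zero_lt_of_lt hf.ht) hb <|
      .block_cons <| .sub hs (by decide) (by decide) <| .block_cons <| .div hs (by decide)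
      (by decide) <| .block_cons <| .copy hs (by decide) (by decide) (by decide) <| .block_cons <|
      .const hs (by decide) hb1 <| .block_nil hs <| .block_nil hs <|
      hQ _ ⟨fun i hi => ?_, ?_, ?_, ?_, ?_, ?_, ?_⟩
    case refine_1.refine_8 =>
      simp (disch := omega) only [Function.update_of_ne]
      rw [hm' i (by omega), hm.agrees i hi]
    all_goals simp [hm' 30 (by omega), hm' 31 (by omega), hm' 21 (by omega), hp.r8,
      hp.r30, hp.r31, hm.r21, *]
  · simp [hm' 20 (by omega), hm.r20] at h

theorem wp_return_false_last (h₀ : c.Params m₀) (hf : FrameBounds c t x y 0 h)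
    (hm : Returns m₀ 0 (pushFrame c.D t x y 0 h K) m)
    (hQ : ∀ m', Returns m₀ 0 K m' → Q m') :
    WP c.s c.b (.savitchStep c.pσ) Q m := by
  have hs := c.hs
  have hp := hm.agrees.params h₀
  refine .branch (fun h => (h hm.r13).elim) fun _ => .branch (fun _ => ?_)
    fun h => (hf.pos (hm.r17 ▸ h)).elim
  refine .block_cons (.popFrame hs hp.r8 hm.r17 hf.ht hf.hx hf.hy hf.hw hf.hh
    fun m' hm' h14 h15 h16 h17 h18 h19 => .block_cons (.branch
      (fun h => ?_) fun _ => .branch (fun h => (h h18).elim) fun _ => .skip hs (.block_nil hs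
        (hQ _ ⟨fun i hi => ?_, ?_, ?_, ?_, ?_⟩))))
  · simp [hm' 20 (by omega), hm.r20] at h
  · rw [hm' i (by omega), hm.agrees i hi]
  · rw [hm' _ (by omega), hm.r13]
  · rw [hm' _ (by omega), hm.r20]
  · exact h17
  · rw [hm' _ (by omega), hm.r21]

/-- The failure of either half discards the midpoint, whatever the flag `h` is; the next candidate
starts again with the first half. -/
theorem wp_return_false_next (h₀ : c.Params m₀) (hf : FrameBounds c t x y (w + 1) h)
    (hm : Returns m₀ 0 (pushFrame c.D t x y (w + 1) h K) m)
    (hb : pushFrame c.D t x y w 0 K < 2 ^ c.b)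
    (hQ : ∀ m', Calls m₀ (t / 2) x w (pushFrame c.D t x y w 0 K) m' → Q m') :
    WP c.s c.b (.savitchStep c.pσ) Q m := by
  have hs := c.hs
  have hp := hm.agrees.params h₀
  have hb1 : 1 < 2 ^ c.b := lt_of_lt_of_le (by have := hf.hw; omega) c.base_le
  refine .branch (fun h => (h hm.r13).elim) fun _ => .branch (fun _ => ?_)
    fun h => (hf.pos (hm.r17 ▸ h)).elim
  refine .block_cons (.popFrame hs hp.r8 hm.r17 hf.ht hf.hx hf.hy hf.hw hf.hh
    fun m' hm' h14 h15 h16 h17 h18 h19 => .block_cons (.branch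
      (fun h => ?_) fun _ => .branch (fun _ => ?_) fun h => by simp [h18] at h))
  · simp [hm' 20 (by omega), hm.r20] at h
  · refine .block_cons <| .sub hs (by decide) (by decide) <| .block_cons <| .const hs (by decide)
      (by positivity) <| .block_cons <| .pushFrame hs (D := c.D)
      (t := t) (x := x) (y := y) (w := w) (h := 0) (K := K) ?_ ?_ ?_ ?_ ?_ ?_ ?_
      (Nat.zero_lt_of_lt hf.ht) hb <|
      .block_cons <| .div hs (by decide)
      (by decide) <| .block_cons <| .copy hs (by decide) (by decide) (by decide) <| .block_cons <|
      .const hs (by decide) hb1 <| .block_nil hs <| .block_nil hs <|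
      hQ _ ⟨fun i hi => ?_, ?_, ?_, ?_, ?_, ?_, ?_⟩
    case refine_2.refine_8 =>
      simp (disch := omega) only [Function.update_of_ne]
      rw [hm' i (by omega), hm.agrees i hi]
    all_goals simp [hm' 30 (by omega), hm' 31 (by omega), hm' 21 (by omega), hp.r8,
      hp.r30, hp.r31, hm.r21, *]

end Steps

end SearchData

/-! ### Correctness of the whole search and the size of its stack -/

namespace SearchData

variable {c : SearchData}

/-- There is a word of length `t + 1` that leads from the pair `x` to the pair `y`. -/
abbrev Reach (c : SearchData) : ℕ → ℕ → ℕ → Prop := ReachSucc c.Step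

theorem Valid.reach {t x y : ℕ} (hx : c.Valid x) (h : c.Reach t x y) : c.Valid y :=
  h.preserves (V := c.Valid) (fun _ _ => Valid.step) hx

/-- For `t ≥ 1`, the `t + 1` steps split into `t / 2 + 1` and `(t - 1) / 2 + 1` steps. Both new
indices are less than `2 ^ l` whenever `t < 2 ^ (l + 1)`. -/
theorem reach_iff_halves {t : ℕ} (ht : t ≠ 0) (x y : ℕ) :
    c.Reach t x y ↔ ∃ w, c.Reach (t / 2) x w ∧ c.Reach ((t - 1) / 2) w y := by
  conv_lhs => rw [show t = t / 2 + (t - 1) / 2 + 1 by omega]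
  exact reachSucc_add _ _ _ _ _

/-- The recursion is flattened into one loop, so the claim is stated with continuations: `hQ₁` and
`hQ₀` say that the remaining loop iterations are correct after a positive or negative answer.
Induction on `l` then nests the calls. Each level puts five more digits in base `D` on the stack,
hence the exponent `e + 5 * l`.

The target `y` is only required to be below `D`, because arbitrary candidates are tried as
midpoints. The source `x` must be a valid pair, because the transition program is run on its
components. -/
theorem wp_savitch_loop {m₀ : Store} (h₀ : c.Params m₀) {l t x y K e : ℕ} (htl : t < 2 ^ l)
    (ht : t < c.D) (hx : c.Valid x) (hy : y < c.D) (hK : K < c.D ^ e)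
    (hb : c.D ^ (e + 5 * l) ≤ 2 ^ c.b) {Q : Store → Prop}
    (hQ₁ : ∀ m, c.Reach t x y → Returns m₀ 1 K m →
      WP c.s c.b (.loop 21 (.savitchStep c.pσ)) Q m)
    (hQ₀ : ∀ m, ¬ c.Reach t x y → Returns m₀ 0 K m →
      WP c.s c.b (.loop 21 (.savitchStep c.pσ)) Q m) {m : Store} (hm : Calls m₀ t x y K m) :
    WP c.s c.b (.loop 21 (.savitchStep c.pσ)) Q m := by
  induction l generalizing t x y K e Q m with
  | zero =>
    obtain rfl : t = 0 := by simpa using htl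
    refine .loop_step (by simp [hm.r21]) (wp_call_zero h₀ hx hm fun m' h₁ h₂ => ?_)
    by_cases h : c.Step x y
    · exact hQ₁ _ h (h₁ h)
    · exact hQ₀ _ h (h₂ h)
  | succ l ih =>
    by_cases ht0 : t = 0
    · subst ht0
      refine .loop_step (by simp [hm.r21]) (wp_call_zero h₀ hx hm fun m' h₁ h₂ => ?_)
      by_cases h : c.Step x y
      · exact hQ₁ _ h (h₁ h)
      · exact hQ₀ _ h (h₂ h)
    have hD : 0 < c.D := Nat.zero_lt_of_lt ht
    have hsq := c.sq_lt
    have hx' := (Valid.lt hx).trans hsq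
    have hpush : ∀ {w h}, w < c.D → h < c.D →
        pushFrame c.D t x y w h K < c.D ^ (e + 5) := fun hw hh => pushFrame_lt hK ht hx' hy hw hh
    have hb₁ : c.D ^ (e + 5) ≤ 2 ^ c.b := (Nat.pow_le_pow_right hD (by omega)).trans hb
    have hb₂ : c.D ^ (e + 5 + 5 * l) ≤ 2 ^ c.b := by convert hb using 2; ring
    have hpow : 2 ^ (l + 1) = 2 * 2 ^ l := by ring
    have hD1 : 1 < c.D := by
      have h1 := Nat.zero_lt_of_lt (Valid.lt hx)
      omega
    -- Induction on the candidate `w` that has just failed, assuming that no candidate from `w`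
    -- upwards is a midpoint of a path.
    have inner : ∀ w < c.D, ∀ h < c.D,
        (∀ v, w ≤ v → ¬ (c.Reach (t / 2) x v ∧ c.Reach ((t - 1) / 2) v y)) →
        ∀ m, Returns m₀ 0 (pushFrame c.D t x y w h K) m →
          WP c.s c.b (.loop 21 (.savitchStep c.pσ)) Q m := by
      intro w
      induction w with
      | zero =>
        intro hw h hh hno m hm
        refine .loop_step (by simp [hm.r21]) (wp_return_false_last h₀ ⟨ht0, ht, hx', hy, hw, hh⟩ hm
          fun m' hm' => hQ₀ _ ?_ hm')
        rw [reach_iff_halves ht0]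
        rintro ⟨v, hv⟩
        exact hno v (Nat.zero_le _) hv
      | succ w ihw =>
        intro hw h hh hno m hm
        have hw' : w < c.D := by omega
        have next : ¬ (c.Reach (t / 2) x w ∧ c.Reach ((t - 1) / 2) w y) →
            ∀ v, w ≤ v → ¬ (c.Reach (t / 2) x v ∧ c.Reach ((t - 1) / 2) v y) := by
          intro h v hv
          rcases hv.eq_or_lt with rfl | hv
          · exact h
          · exact hno v hv
        refine .loop_step (by simp [hm.r21]) (wp_return_false_next h₀ ⟨ht0, ht, hx', hy, hw, hh⟩ hm
          ((hpush hw' hD).trans_le hb₁) fun m' hm' => ?_)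
        refine ih (by omega) (by omega) hx hw' (hpush hw' hD) hb₂ (fun m₁ r₁ hm₁ => ?_)
          (fun m₁ r₁ hm₁ => ihw hw' 0 hD (next fun h => r₁ h.1) m₁ hm₁) hm'
        refine .loop_step (by simp [hm₁.r21]) (wp_return_true_first h₀ ⟨ht0, ht, hx', hy, hw', hD⟩
          hm₁ ((hpush hw' hD1).trans_le hb₁) fun m₂ hm₂ => ?_)
        -- The midpoint has just been reached from the valid pair `x`, so it is itself valid and may
        -- serve as a source.
        refine ih (by omega) (by omega) (Valid.reach hx r₁) hy (hpush hw' hD1) hb₂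
          (fun m₃ r₂ hm₃ => ?_) (fun m₃ r₂ hm₃ => ihw hw' 1 hD1 (next fun h => r₂ h.2) m₃ hm₃) hm₂
        exact .loop_step (by simp [hm₃.r21]) (wp_return_true_second h₀ ⟨ht0, ht, hx', hy, hw', hD1⟩
          hm₃ fun m₄ hm₄ => hQ₁ _ ((reach_iff_halves ht0 _ _).mpr ⟨w, r₁, r₂⟩) hm₄)
    refine .loop_step (by simp [hm.r21]) (wp_call_pos h₀ ht0 hm ((hpush (by omega) hD).trans_le hb₁)
      fun m' hm' => inner (c.D - 1) (by omega) 0 hD ?_ m' hm')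
    -- Whatever is reachable from `x` is a valid pair, so it is below `B * B ≤ D - 1`; no midpoint
    -- is missed by starting at `D - 1`.
    rintro v hv ⟨h₁, -⟩
    have := Valid.lt (Valid.reach hx h₁)
    omega

theorem wp_savitch {m : Store} (hm : c.Params m) {l : ℕ} (htl : m 14 < 2 ^ l) (ht : m 14 < c.D)
    (hx : c.Valid (m 15)) (hy : m 16 < c.D) (hb : c.D ^ (5 * l) ≤ 2 ^ c.b) {Q : Store → Prop}
    (hQ : ∀ m', Agrees m m' → (m' 20 ≠ 0 ↔ c.Reach (m 14) (m 15) (m 16)) → Q m') :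
    WP c.s c.b (.savitch c.pσ) Q m := by
  have hs := c.hs
  have hb1 : 1 < 2 ^ c.b := by
    have h1 := Nat.zero_lt_of_lt (Valid.lt hx)
    exact lt_of_lt_of_le (by have := c.sq_lt; omega) c.base_le
  have fin : ∀ {r m'}, Returns m r 0 m' → (r ≠ 0 ↔ c.Reach (m 14) (m 15) (m 16)) →
      WP c.s c.b (.loop 21 (.savitchStep c.pσ)) (WP c.s c.b (.block []) Q) m' := fun hm' hr =>
    .loop_step (by simp [hm'.r21]) (wp_return_empty hm' fun m₂ h₁ h₂ h₃ =>
      .loop_done hs h₃ (.block_nil hs (hQ _ h₁ (by rwa [h₂]))))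
  refine .block_cons <| .const hs (by decide) (by positivity) <| .block_cons <|
    .const hs (by decide) hb1 <| .block_cons <| .const hs (by decide) hb1 <| .block_cons <|
    wp_savitch_loop (e := 0) hm htl ht hx hy (K := 0) (by simp) (by simpa using hb)
      (fun m' h hm' => fin hm' (by simpa using h)) (fun m' h hm' => fin hm' (by simpa using h))
      ⟨fun i hi => ?_, ?_, ?_, ?_, ?_, ?_, ?_⟩
  · simp (disch := omega) only [Function.update_of_ne]
  all_goals simp

end SearchData

/-! ## The aggregator -/

/-- Look for a state `q` such that some word of length `j + 1` leads from `0` to `q₂` and from `q₁` to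
`q`, where `q₁`, `j`, `q₂` are in registers 10, 11, 12. The result is written into register 29. -/
def Prog.joinStates (pσ : Prog) : Prog := .block [
  .copy 29 10, .copy 28 7,
  .loop 28 (.block [
    .arith .sub 28 28 30, .copy 14 11, .copy 15 10, .arith .mul 16 12 7, .arith .add 16 16 28,
    .savitch pσ, .branch 20 (.copy 29 28) .skip])]

/-- The number of binary digits of register 0 is written into register 14. -/
def Prog.digits : Prog := .block [
  .copy 13 0, .const 14 0, .loop 13 (.block [.arith .div 13 13 31, .arith .add 14 14 30])]

/-- Write `2 ^ polylog C n` into register 7, where `n` is in register 0. -/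
def Prog.stateBound (C : ℕ) : Prog := .block [
  .digits, .const 15 C, .block (List.replicate C (.arith .mul 15 15 14)), .const 7 1,
  .loop 15 (.block [.arith .sub 15 15 30, .arith .add 7 7 7])]

/-- Fill in the registers that the search expects. -/
def Prog.setup (C : ℕ) : Prog := .block [
  .const 30 1, .const 31 2, .arith .add 6 0 30, .stateBound C, .arith .mul 8 7 7,
  .arith .add 8 8 6]

/-- Split the messages in registers 4 and 5 into count and state. -/
def Prog.decode : Prog := .block [
  .arith .mod 9 4 6, .arith .div 10 4 6, .arith .mod 11 5 6, .arith .div 12 5 6]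

/-- Combine the counts in registers 9 and 11 and the state in register 29. -/
def Prog.encode : Prog := .block [
  .arith .add 9 9 11, .arith .add 9 9 30, .arith .mod 9 9 6, .arith .mul 29 29 6,
  .arith .add 0 9 29]

/-- The aggregator of the mud algorithm. -/
def Prog.aggregate (C : ℕ) (pσ : Prog) : Prog :=
  .block [.setup C, .decode, .joinStates pσ, .encode]

/-- The pair `(0, q₁)` has code `q₁`, so the search starts from register 10 itself. The result
register is initialized with `q₁`, which keeps it below `card` if nothing is found. If several
states qualify, any one of them serves, and later finds overwrite earlier ones. -/
theorem SearchData.wp_joinStates {c : SearchData} {m : Store} (hm : c.Params m)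
    (h10 : m 10 < c.card) (h12 : m 12 < c.card) {l : ℕ} (h11 : m 11 < 2 ^ l) (h11' : m 11 < c.D)
    (hb : c.D ^ (5 * l) ≤ 2 ^ c.b) {Q : Store → Prop}
    (hQ : ∀ m' : Store, (∀ i, i < 13 ∨ 29 < i → m' i = m i) → m' 29 < c.card →
      (∀ q < c.B, c.Reach (m 11) (m 10) (m 12 * c.B + q) →
        c.Reach (m 11) (m 10) (m 12 * c.B + m' 29)) → Q m') :
    WP c.s c.b (.joinStates c.pσ) Q m := by
  have hs := c.hs
  have hB10 := h10.trans_le c.card_le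
  have hB12 := h12.trans_le c.card_le
  have hx : c.Valid (m 10) := by
    simpa using Valid.mk (c := c) (u := 0) (Nat.zero_lt_of_lt h10) h10
  have hbB := c.sq_lt.trans_le c.base_le
  refine .block_cons <| .copy hs (by decide) (by decide) (by decide) <| .block_cons <|
    .copy hs (by decide) (by decide) (by decide) <| .block_cons <| .loop_count hs (fun m' =>
      (∀ i, i < 13 ∨ 29 < i → m' i = m i) ∧ m' 28 ≤ c.B ∧ m' 29 < c.card ∧
      ∀ q < c.B, m' 28 ≤ q → c.Reach (m 11) (m 10) (m 12 * c.B + q) →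
        c.Reach (m 11) (m 10) (m 12 * c.B + m' 29)) ?_ ?_ ?_
  · rintro m₁ k ⟨hI, h28, h29, hq⟩ hk
    have p7 := (hI 7 (by decide)).trans hm.r7
    have p8 := (hI 8 (by decide)).trans hm.r8
    have p10 := hI 10 (by decide)
    have p11 := hI 11 (by decide)
    have p12 := hI 12 (by decide)
    have p30 := (hI 30 (by decide)).trans hm.r30
    have hsq := mul_add_lt_sq hB12 (show k < c.B by omega)
    refine .block_cons <| .sub hs (by decide) (by decide) <| .block_cons <| .copy hs (by decide)
      (by decide) (by decide) <| .block_cons <| .copy hs (by decide) (by decide) (by decide) <|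
      .block_cons <| .mul hs (by decide) ?_ <| .block_cons <| .add hs (by decide) ?_ <|
      .block_cons <| wp_savitch (l := l) ⟨?_, ?_, ?_, ?_, ?_, ?_, ?_, ?_⟩ ?_ ?_ ?_ ?_ hb
        fun m₂ hm₂ h20 => .block_cons <| .branch
        (fun h => .copy hs (by decide) (by decide) (by decide) (.block_nil hs ?_))
        (fun h => .skip hs (.block_nil hs ?_))
    · simp [p12, p7]; omega
    · simp [p12, p7, hk, p30]; omega
    · simp [hI 0, hm.r0]
    · simp [hI 1, hm.r1]
    · simp [hI 2, hm.r2]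
    · simp [hI 3, hm.r3]
    · simp [p7]
    · simp [p8]
    · simp [p30]
    · simp [hI 31, hm.r31]
    · simpa [p11] using h11
    · simpa [p11] using h11'
    · simpa [p10] using hx
    · simp [p12, p7, hk, p30]; have := c.sq_lt; omega
    all_goals
      simp [p12, p7, hk, p30, p10, p11] at h20
      have e28 : m₂ 28 = k := by rw [hm₂ _ (by decide)]; simp [hk, p30]
      have e29 : m₂ 29 = m₁ 29 := by rw [hm₂ _ (by decide)]; simp
      have eI : ∀ i, i < 13 ∨ 29 < i → m₂ i = m i := fun i hi => by
        rw [hm₂ i (by omega), ← hI i hi]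
        simp (disch := omega) only [Function.update_of_ne]
    · have hr := h20.mp h
      refine ⟨⟨fun i hi => ?_, ?_, ?_, fun q _ _ _ => ?_⟩, ?_⟩
      · simp (disch := omega) only [Function.update_of_ne]
        exact eI i hi
      · simp [e28]; omega
      -- The candidates run over all numbers below `B`, since the program does not know `card`; one
      -- that is reached is a state automatically.
      · have := (Valid.reach hx hr).2
        rw [mul_comm, Nat.mul_add_mod, Nat.mod_eq_of_lt (by omega)] at this
        simpa [e28] using this
      · simpa [e28] using hr
      · simp [e28]
    · refine ⟨⟨eI, by omega, by omega, fun q hq' hle hr => ?_⟩, e28⟩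
      rw [e29]
      refine hq q hq' ?_ hr
      rcases hle.eq_or_lt with rfl | hlt
      · rw [e28] at hr
        exact (h20.not_right.mp (by simpa using h) hr).elim
      · omega
  · rintro m₁ ⟨hI, -, h29, hq⟩ h28
    exact .block_nil hs (hQ _ hI h29 fun q hq' => hq q hq' (by omega))
  · refine ⟨fun i hi => ?_, ?_, ?_, fun q hq hle => ?_⟩
    · simp (disch := omega) only [Function.update_of_ne]
    · simp [hm.r7]
    · simpa using h10
    · simp [hm.r7] at hle
      omega

/-! ### Arithmetic of the aggregator: bounds, decoding and encoding -/

section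

variable {s b : ℕ} {Q : Store → Prop} {m : Store}

theorem WP.digits (hs : lowWidth * b ≤ s) (h30 : m 30 = 1) (h31 : m 31 = 2) (hn : 1 ≤ m 0)
    (hQ : ∀ m' : Store, (∀ i, i ≠ 13 → i ≠ 14 → m' i = m i) → m' 14 = Nat.log 2 (m 0) + 1 → Q m') :
    WP s b .digits Q m := by
  refine .of_tame fun tame => ?_
  have hlog : Nat.log 2 (m 0) + 1 < 2 ^ b :=
    lt_of_le_of_lt (Nat.log_lt_self 2 (by omega)) (tame.1 0 (by decide))
  refine .block_cons <| .copy hs (by decide) (by decide) (by decide) <| .block_cons <|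
    .const hs (by decide) (by positivity) <| .block_cons <| .loop_variant hs (fun m' =>
      (∀ i, i ≠ 13 → i ≠ 14 → m' i = m i) ∧
      -- The digits counted plus the digits left are constant. The case distinction is needed
      -- because `Nat.log 2 0 + 1` is `1`, while `0` has no digits left.
      m' 14 + (if m' 13 = 0 then 0 else Nat.log 2 (m' 13) + 1) = Nat.log 2 (m 0) + 1) ?_ ?_ ?_
  · rintro m₁ ⟨hI, hlg⟩ h13
    rw [if_neg h13] at hlg
    have p30 := (hI 30 (by decide) (by decide)).trans h30
    have p31 := (hI 31 (by decide) (by decide)).trans h31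
    refine .block_cons <| .div hs (by decide) (by decide) <| .block_cons <| .add hs (by decide) ?_ <|
      .block_nil hs ⟨⟨fun i hi hi' => ?_, ?_⟩, ?_⟩
    · simp [p30]; omega
    · simp (disch := omega) only [Function.update_of_ne]
      exact hI i hi hi'
    · simp only [ne_eq, Nat.reduceEqDiff, not_false_eq_true,
        Function.update_of_ne, Function.update_self, p30, p31]
      by_cases h1 : m₁ 13 = 1
      · simp [h1] at hlg ⊢; omega
      · rw [if_neg (by omega), Nat.log_div_base]
        have : 0 < Nat.log 2 (m₁ 13) := Nat.log_pos (by decide) (by omega)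
        omega
    · simp [p31]; omega
  · rintro m₁ ⟨hI, hlg⟩ h13
    exact .block_nil hs (hQ _ hI (by simpa [h13] using hlg))
  · refine ⟨fun i hi hi' => ?_, ?_⟩
    · simp (disch := omega) only [Function.update_of_ne]
    · simp; omega

theorem WP.mul_replicate (hs : lowWidth * b ≤ s) (k : ℕ) (h14 : 1 ≤ m 14)
    (hb : m 15 * m 14 ^ k < 2 ^ b)
    (hQ : Q (Function.update m 15 (m 15 * m 14 ^ k))) :
    WP s b (.block (List.replicate k (.arith .mul 15 15 14))) Q m := by
  induction k generalizing m with
  | zero => exact .block_nil hs (by simpa using hQ)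
  | succ k ih =>
    have e : m 15 * m 14 ^ (k + 1) = m 15 * m 14 * m 14 ^ k := by ring
    rw [e] at hb hQ
    refine .block_cons (.mul hs (by decide) ((Nat.le_mul_of_pos_right _ (by positivity)).trans_lt hb)
      (ih ?_ ?_ ?_)) <;> simpa

/-- The number of states is not among the inputs, so the program works with the bound `2 ^ polylog C
n`. This can be computed from `n`, because `C` is a constant of the program. -/
theorem WP.stateBound (hs : lowWidth * b ≤ s) (h30 : m 30 = 1) (h31 : m 31 = 2) (hn : 1 ≤ m 0)
    {C : ℕ} (hb : polylog C (m 0) < b)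
    (hQ : ∀ m' : Store, (∀ i, i ≠ 7 → i < 13 ∨ 15 < i → m' i = m i) →
      m' 7 = 2 ^ polylog C (m 0) → Q m') :
    WP s b (.stateBound C) Q m := by
  have hbb : 2 ^ polylog C (m 0) < 2 ^ b := Nat.pow_lt_pow_right (by decide) hb
  have hlt : polylog C (m 0) < 2 ^ b := Nat.lt_two_pow_self.trans hbb
  have hC : C ≤ polylog C (m 0) := Nat.le_mul_of_pos_right _ (by positivity)
  refine .block_cons <| .digits hs h30 h31 hn fun m₁ h₁ h14 => .block_cons <|
    .const hs (by decide) (by omega) <| .block_cons <| .mul_replicate hs C (by simp [h14]) ?_ <|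
    .block_cons <| .const hs (by decide) (Nat.one_lt_two_pow (by omega)) <| .block_cons <|
    .loop_count hs (fun m' => (∀ i, i ≠ 7 → i < 13 ∨ 15 < i → m' i = m i) ∧
      m' 15 ≤ polylog C (m 0) ∧ m' 7 = 2 ^ (polylog C (m 0) - m' 15)) ?_ ?_ ?_
  · simpa [h14, polylog] using hlt
  · rintro m₂ k ⟨hI, hle, h7⟩ hk
    have e : m₂ 7 + m₂ 7 = 2 ^ (polylog C (m 0) - k) := by
      rw [h7, hk, ← two_mul, ← pow_succ']
      congr 1
      omega
    have p30 := (hI 30 (by omega) (by omega)).trans h30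
    refine .block_cons <| .sub hs (by decide) (by decide) <| .block_cons <| .add hs (by decide) ?_ <|
      .block_nil hs ⟨⟨fun i hi hi' => ?_, ?_, ?_⟩, ?_⟩
    · simp only [ne_eq, Nat.reduceEqDiff, not_false_eq_true, Function.update_of_ne, e]
      exact (Nat.pow_le_pow_right (by decide) (Nat.sub_le _ _)).trans_lt hbb
    · simp (disch := omega) only [Function.update_of_ne]
      exact hI i hi hi'
    · simp [hk, p30]; omega
    · simp [hk, p30, e]
    · simp [hk, p30]
  · rintro m₂ ⟨hI, -, h7⟩ h15
    exact .block_nil hs (hQ _ hI (by simpa [h15] using h7))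
  · refine ⟨fun i hi hi' => ?_, ?_, ?_⟩
    · simp (disch := omega) only [Function.update_of_ne, h₁]
    · simp [h14, polylog]
    · simp [h14, polylog]

/-- The base `B * B + (n + 1)` of the stack exceeds every code of a pair and every count, so all the
entries of a frame are digits in this base. -/
theorem WP.setup (hs : lowWidth * b ≤ s) (hn : 1 ≤ m 0) {C : ℕ}
    (hb : 2 ^ polylog C (m 0) * 2 ^ polylog C (m 0) + (m 0 + 1) < 2 ^ b)
    (hQ : ∀ m' : Store, (∀ i < 6, m' i = m i) → m' 6 = m 0 + 1 → m' 7 = 2 ^ polylog C (m 0) →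
      m' 8 = 2 ^ polylog C (m 0) * 2 ^ polylog C (m 0) + (m 0 + 1) → m' 30 = 1 → m' 31 = 2 →
      Q m') :
    WP s b (.setup C) Q m := by
  have hTb : polylog C (m 0) < b := by
    refine (Nat.pow_lt_pow_iff_right (a := 2) (by decide)).mp ?_
    have := Nat.le_mul_self (2 ^ polylog C (m 0))
    omega
  refine .block_cons <| .const hs (by decide) (by omega) <| .block_cons <|
    .const hs (by decide) (by omega) <| .block_cons <|
    .add hs (by decide) ?_ <| .block_cons <| .stateBound (C := C) hs ?_ ?_ ?_ ?_ fun m₁ h₁ h7 =>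
    .block_cons <| .mul hs (by decide) ?_ <| .block_cons <| .add hs (by decide) ?_ <|
    .block_nil hs <| hQ _ (fun i hi => ?_) ?_ ?_ ?_ ?_ ?_
  · simp; omega
  · simp
  · simp
  · simpa using hn
  · simpa using hTb
  all_goals simp at h7
  · rw [h7]; omega
  · simp [h7, h₁ 6]; omega
  · simp (disch := omega) only [Function.update_of_ne, h₁]
  · simp [h₁ 6]
  · simp [h7]
  · simp [h7, h₁ 6]
  · simp [h₁ 30]
  · simp [h₁ 31]

theorem WP.decode (hs : lowWidth * b ≤ s) (hQ : ∀ m' : Store, (∀ i, i < 9 ∨ 12 < i → m' i = m i) →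
      m' 9 = m 4 % m 6 → m' 10 = m 4 / m 6 → m' 11 = m 5 % m 6 → m' 12 = m 5 / m 6 → Q m') :
    WP s b .decode Q m := by
  refine .block_cons <| .mod hs (by decide) (by decide) <| .block_cons <| .div hs (by decide)
    (by decide) <| .block_cons <| .mod hs (by decide) (by decide) <| .block_cons <|
    .div hs (by decide) (by decide) <| .block_nil hs <| hQ _ (fun i hi => ?_) ?_ ?_ ?_ ?_
  · simp (disch := omega) only [Function.update_of_ne]
  all_goals simp

/-- Counts are stored minus one, hence the extra `1` in the sum. The remainder changes nothing for
messages from disjoint sets of inputs; it only keeps the value in range for pairs of messages that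
never meet. -/
theorem WP.encode (hs : lowWidth * b ≤ s) (h30 : m 30 = 1) (hb₁ : m 9 + m 11 + 1 < 2 ^ b)
    (hb : (m 9 + m 11 + 1) % m 6 + m 6 * m 29 < 2 ^ b)
    (hQ : ∀ m' : Store, m' 0 = (m 9 + m 11 + 1) % m 6 + m 6 * m 29 → Q m') :
    WP s b .encode Q m := by
  rw [mul_comm] at hb hQ
  refine .block_cons <| .add hs (by decide) (by omega) <| .block_cons <|
    .add hs (by decide) ?_ <| .block_cons <| .mod hs (by decide) (by decide) <| .block_cons <|
    .mul hs (by decide) ?_ <| .block_cons <| .add hs (by decide) ?_ <| .block_nil hs <| hQ _ ?_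
  all_goals simp [h30]
  all_goals omega

end

/-! ### Size bounds and correctness of the aggregator -/

/-- The bound on the registers of the aggregator. -/
def aggregateBits (C n : ℕ) : ℕ :=
  (2 * polylog C n + (Nat.log 2 n + 1) + 1) * (5 * (Nat.log 2 n + 1))

/-- The base of the stack of the aggregator. -/
def aggregateBase (C n : ℕ) : ℕ := 2 ^ polylog C n * 2 ^ polylog C n + (n + 1)

/-- With `T = polylog C n` and `L = Nat.log 2 n + 1`, the base is at most `2 ^ (2 * T + L + 1)`. The
search has depth at most `L`, because counts are below `2 ^ L`, and each level takes five digits. -/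
theorem aggregateBase_pow_le (C n : ℕ) :
    aggregateBase C n ^ (5 * (Nat.log 2 n + 1)) ≤ 2 ^ aggregateBits C n := by
  rw [aggregateBits, pow_mul 2]
  refine Nat.pow_le_pow_left ?_ _
  rw [aggregateBase]
  generalize polylog C n = T
  have hnL : n < 2 ^ (Nat.log 2 n + 1) := Nat.lt_pow_succ_log_self (by decide) n
  generalize Nat.log 2 n + 1 = L at hnL
  have e₁ : 2 ^ (2 * T + L + 1) = 2 ^ T * 2 ^ T * 2 ^ L + 2 ^ T * 2 ^ T * 2 ^ L := by ring
  have e₂ : 2 ^ T * 2 ^ T ≤ 2 ^ T * 2 ^ T * 2 ^ L := Nat.le_mul_of_pos_right _ (by positivity)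
  have e₃ : 2 ^ L ≤ 2 ^ T * 2 ^ T * 2 ^ L := Nat.le_mul_of_pos_left _ (by positivity)
  omega

theorem aggregateBase_sq_le (C n : ℕ) :
    aggregateBase C n * aggregateBase C n ≤ 2 ^ aggregateBits C n := by
  refine le_trans ?_ (aggregateBase_pow_le C n)
  rw [← pow_two]
  exact Nat.pow_le_pow_right (by unfold aggregateBase; positivity) (by omega)

theorem message_lt_aggregateBase_sq {C n j q card : ℕ} (hcard : card ≤ 2 ^ polylog C n)
    (hj : j < n + 1) (hq : q < card) :
    j + (n + 1) * q < aggregateBase C n * aggregateBase C n := by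
  have h1 : j + (n + 1) * q < (n + 1) * card := by nlinarith
  refine h1.trans_le (Nat.mul_le_mul ?_ (hcard.trans ?_)) <;> unfold aggregateBase
  · omega
  · exact (Nat.le_mul_self _).trans (Nat.le_add_right _ _)

theorem message_div {j n : ℕ} (hj : j < n + 1) (q : ℕ) : (j + (n + 1) * q) / (n + 1) = q := by
  rw [Nat.add_mul_div_left _ _ (by omega), Nat.div_eq_of_lt hj, zero_add]

theorem message_mod {j n : ℕ} (hj : j < n + 1) (q : ℕ) : (j + (n + 1) * q) % (n + 1) = j := by
  rw [Nat.add_mul_mod_self_left, Nat.mod_eq_of_lt hj]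

theorem SearchData.wp_aggregate {c : SearchData} {C j₁ j₂ q₁ q₂ : ℕ} (hn : 1 ≤ c.n)
    (hB : c.B = 2 ^ polylog C c.n) (hD : c.D = aggregateBase C c.n)
    (hb : c.b = aggregateBits C c.n) (hj₁ : j₁ < c.n + 1) (hj₂ : j₂ < c.n + 1) (hq₁ : q₁ < c.card)
    (hq₂ : q₂ < c.card) :
    WP c.s c.b (.aggregate C c.pσ) (fun m => ∃ q < c.card, (∀ q' < c.card,
      c.Reach j₂ q₁ (q₂ * c.B + q') → c.Reach j₂ q₁ (q₂ * c.B + q)) ∧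
      m 0 = (j₁ + j₂ + 1) % (c.n + 1) + (c.n + 1) * q)
      (fun i => [c.n, c.S, c.k, c.R, j₁ + (c.n + 1) * q₁, j₂ + (c.n + 1) * q₂].getD i 0) := by
  have hs := c.hs
  have hsq := aggregateBase_sq_le C c.n
  have hpow := aggregateBase_pow_le C c.n
  rw [← hD, ← hb] at hsq hpow
  have hcard := c.card_le
  rw [hB] at hcard
  have hD' : 2 ^ polylog C c.n * 2 ^ polylog C c.n + (c.n + 1) = c.D := hD.symm
  have hD1 : 2 * c.D < 2 ^ c.b + 1 := by
    have : 1 ≤ 2 ^ polylog C c.n * 2 ^ polylog C c.n := Nat.mul_pos (by positivity) (by positivity)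
    nlinarith
  have hnD : c.n + 1 < c.D := by
    have : 1 ≤ 2 ^ polylog C c.n * 2 ^ polylog C c.n := Nat.mul_pos (by positivity) (by positivity)
    omega
  generalize hm₀ : (fun i => [c.n, c.S, c.k, c.R, j₁ + (c.n + 1) * q₁,
    j₂ + (c.n + 1) * q₂].getD i 0) = m₀
  have r0 : m₀ 0 = c.n := by subst hm₀; rfl
  have r1 : m₀ 1 = c.S := by subst hm₀; rfl
  have r2 : m₀ 2 = c.k := by subst hm₀; rfl
  have r3 : m₀ 3 = c.R := by subst hm₀; rfl
  have r4 : m₀ 4 = j₁ + (c.n + 1) * q₁ := by subst hm₀; rfl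
  have r5 : m₀ 5 = j₂ + (c.n + 1) * q₂ := by subst hm₀; rfl
  clear hm₀
  refine .block_cons <| .setup (C := C) hs (by omega) (by rw [r0, hD']; omega)
    fun m₁ h₁ h6 h7 h8 h30 h31 => .block_cons <| .decode hs fun m₂ h₂ h9 h10 h11 h12 => ?_
  rw [r0] at h6 h7 h8
  rw [h₁ 4 (by decide), h6, r4] at h9 h10
  rw [h₁ 5 (by decide), h6, r5] at h11 h12
  rw [message_mod hj₁] at h9
  rw [message_mod hj₂] at h11
  rw [message_div hj₁] at h10
  rw [message_div hj₂] at h12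
  have t6 := (h₂ 6 (by decide)).trans h6
  have t30 := (h₂ 30 (by decide)).trans h30
  refine .block_cons <| SearchData.wp_joinStates (l := Nat.log 2 c.n + 1)
    ⟨by rw [h₂ _ (by decide), h₁ _ (by decide), r0],
      by rw [h₂ _ (by decide), h₁ _ (by decide), r1],
      by rw [h₂ _ (by decide), h₁ _ (by decide), r2],
      by rw [h₂ _ (by decide), h₁ _ (by decide), r3],
      by rw [h₂ _ (by decide), h7, hB], by rw [h₂ _ (by decide), h8, hD'], t30,
      by rw [h₂ _ (by decide), h31]⟩ (by rwa [h10]) (by rwa [h12])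
    (by rw [h11]; have := Nat.lt_pow_succ_log_self (b := 2) (by decide) c.n; omega)
    (by rw [h11]; omega) hpow fun m₃ h₃ h29 hr => ?_
  rw [h11, h10, h12] at hr
  have u9 := (h₃ 9 (by decide)).trans h9
  have u11 := (h₃ 11 (by decide)).trans h11
  have u6 := (h₃ 6 (by decide)).trans t6
  have u30 := (h₃ 30 (by decide)).trans t30
  have hres := message_lt_aggregateBase_sq hcard (Nat.mod_lt (j₁ + j₂ + 1) (Nat.succ_pos c.n)) h29
  rw [← hD] at hres
  refine .block_cons <| .encode hs u30 ?_ ?_ fun m₄ h₄ => .block_nil hs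
    ⟨m₃ 29, h29, fun q' hq' => hr q' (hq'.trans_le c.card_le), ?_⟩
  · rw [u9, u11]; omega
  · rw [u9, u11, u6]; omega
  · rw [h₄, u9, u11, u6]

/-- The state `q` is whatever the deterministic program outputs. The aggregator of the mud algorithm
is obtained later by choosing from this statement, so no independent description of the selected
state is needed. -/
theorem exists_aggregate {pσ : Prog} {upd : ℕ → ℕ → ℕ} {C n S k R card j₁ j₂ q₁ q₂ : ℕ}
    (hn : 1 ≤ n)
    (computes : ∀ q < card, ∀ a < S,
      pσ.ComputesInSpace (polylog C n) [n, S, k, R, q, a] (upd q a))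
    (upd_lt : ∀ q < card, ∀ a < S, upd q a < card) (hcard : card ≤ 2 ^ polylog C n)
    (hpar : ∀ x ∈ [n, S, k, R], x < 2 ^ polylog C n)
    (hj₁ : j₁ < n + 1) (hj₂ : j₂ < n + 1) (hq₁ : q₁ < card) (hq₂ : q₂ < card) :
    ∃ q < card, (∀ q' < card,
        ReachSucc (PairStep upd S (2 ^ polylog C n)) j₂ q₁ (q₂ * 2 ^ polylog C n + q') →
        ReachSucc (PairStep upd S (2 ^ polylog C n)) j₂ q₁ (q₂ * 2 ^ polylog C n + q)) ∧
      (Prog.aggregate C pσ).ComputesInSpace (polylog C n + lowWidth * aggregateBits C n)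
        [n, S, k, R, j₁ + (n + 1) * q₁, j₂ + (n + 1) * q₂]
        ((j₁ + j₂ + 1) % (n + 1) + (n + 1) * q) := by
  have hsq := aggregateBase_sq_le C n
  have hD := Nat.le_mul_self (aggregateBase C n)
  have hT : 2 ^ polylog C n ≤ aggregateBase C n :=
    (Nat.le_mul_self _).trans (Nat.le_add_right _ _)
  let c : SearchData := ⟨pσ, upd, n, S, k, R, card, 2 ^ polylog C n, aggregateBase C n, polylog C n,
    polylog C n + lowWidth * aggregateBits C n, aggregateBits C n, le_rfl,
    computes, upd_lt, hcard, by unfold aggregateBase; omega, by omega⟩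
  obtain ⟨m, ⟨q, hq, hq', hm⟩, hc⟩ := Prog.exists_computesInSpace_of_wp (by simp [lowWidth]) (by
    have := message_lt_aggregateBase_sq hcard hj₁ hq₁
    have := message_lt_aggregateBase_sq hcard hj₂ hq₂
    simp only [List.mem_cons, List.not_mem_nil, or_false, forall_eq_or_imp, forall_eq] at hpar ⊢
    obtain ⟨h₁, h₂, h₃, h₄⟩ := hpar
    refine ⟨?_, ?_, ?_, ?_, ?_, ?_⟩ <;> simp only [c] <;> omega)
    (c.wp_aggregate (C := C) (j₁ := j₁) (j₂ := j₂) (q₁ := q₁) (q₂ := q₂) hn rfl rfl rfl hj₁ hj₂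
      hq₁ hq₂)
  exact ⟨q, hq, hq', hm ▸ hc⟩

/-! ## The other components of the two constructions -/

/-- The local function of the mud algorithm made from a streaming algorithm. -/
def Prog.mudLocal (pσ : Prog) : Prog := .block [
  .const 5 0, .call pσ [0, 1, 2, 3, 5, 4] 6, .const 7 1, .arith .add 7 7 0, .arith .mul 0 6 7]

/-- The post-processing operator of the mud algorithm made from a streaming algorithm. -/
def Prog.mudOutput (pη : Prog) : Prog := .block [
  .const 7 1, .arith .add 7 7 0, .arith .div 4 4 7, .call pη [0, 1, 2, 3, 4] 0]

/-- The update operator of the streaming algorithm made from a mud algorithm. -/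
def Prog.streamUpdate (pΦ pAgg : Prog) : Prog := .block [
  .call pΦ [0, 1, 2, 3, 5] 6,
  .branch 4 (.block [.const 7 1, .arith .sub 4 4 7, .call pAgg [0, 1, 2, 3, 4, 6] 6]) .skip,
  .const 7 1, .arith .add 0 6 7]

/-- The output operator of the streaming algorithm made from a mud algorithm. -/
def Prog.streamOutput (pη : Prog) : Prog := .block [
  .branch 4 (.block [.const 5 1, .arith .sub 4 4 5, .call pη [0, 1, 2, 3, 4] 0]) (.const 0 0)]

section

variable {s₀ b n S k R : ℕ}

/-- A single letter has stored count `0`, so its message is just `(n + 1) * q`. The inputs fit into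
the registers because they already count towards the space of the called program. -/
theorem mudLocal_computes {pσ : Prog} {a q : ℕ}
    (h : pσ.ComputesInSpace s₀ [n, S, k, R, 0, a] q) (hs : s₀ ≤ b) (hn : n + 1 < 2 ^ b)
    (hq : (n + 1) * q < 2 ^ b) :
    (Prog.mudLocal pσ).ComputesInSpace (s₀ + lowWidth * b) [n, S, k, R, a] ((n + 1) * q) := by
  have hs' : lowWidth * b ≤ s₀ + lowWidth * b := Nat.le_add_left _ _
  have hin := h.lt_two_pow
  have hpow : 2 ^ s₀ ≤ 2 ^ b := Nat.pow_le_pow_right (by decide) hs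
  refine .of_wp (b := b) (by simp [lowWidth]) (fun x hx => (hin x (by simp at hx ⊢; tauto)).trans_le hpow) ?_
  have hq' : q < 2 ^ b := (Nat.le_mul_of_pos_left q (by omega)).trans_lt hq
  refine .block_cons <| .const hs' (by decide) (by positivity) <| .block_cons <|
    .call le_rfl (out := q) (by simpa using h) (by decide) (by decide) hq' <| .block_cons <|
    .const hs' (by decide) (by omega) <| .block_cons <| .add hs' (by decide) ?_ <| .block_cons <|
    .mul hs' (by decide) ?_ <| .block_nil hs' ?_
  · simp; omega
  · simpa [mul_comm, add_comm] using hq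
  · simp [mul_comm, add_comm]

theorem mudOutput_computes {pη : Prog} {x q : ℕ}
    (h : pη.ComputesInSpace s₀ [n, S, k, R, x / (n + 1)] q) (hs : s₀ ≤ b) (hn : n + 1 < 2 ^ b)
    (hx : x < 2 ^ b) (hq : q < 2 ^ b) :
    (Prog.mudOutput pη).ComputesInSpace (s₀ + lowWidth * b) [n, S, k, R, x] q := by
  have hs' : lowWidth * b ≤ s₀ + lowWidth * b := Nat.le_add_left _ _
  have hin := h.lt_two_pow
  have hpow : 2 ^ s₀ ≤ 2 ^ b := Nat.pow_le_pow_right (by decide) hs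
  refine .of_wp (b := b) (by simp [lowWidth]) (fun y hy => ?_) ?_
  · by_cases e : y = x
    · rwa [e]
    · exact (hin y (by simp at hy ⊢; tauto)).trans_le hpow
  refine .block_cons <| .const hs' (by decide) (by omega) <| .block_cons <|
    .add hs' (by decide) ?_ <| .block_cons <| .div hs' (by decide) (by decide) <| .block_cons <|
    .call le_rfl (out := q) ?_ (by decide) (by decide) hq <| .block_nil hs' ?_
  · simp; omega
  · simpa [add_comm] using h
  · simp

theorem streamUpdate_zero_computes {pΦ pAgg : Prog} {a q : ℕ}
    (h : pΦ.ComputesInSpace s₀ [n, S, k, R, a] q) (hs : s₀ ≤ b) (hq : q + 1 < 2 ^ b) :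
    (Prog.streamUpdate pΦ pAgg).ComputesInSpace (s₀ + lowWidth * b) [n, S, k, R, 0, a]
      (q + 1) := by
  have hs' : lowWidth * b ≤ s₀ + lowWidth * b := Nat.le_add_left _ _
  have hin := h.lt_two_pow
  have hpow : 2 ^ s₀ ≤ 2 ^ b := Nat.pow_le_pow_right (by decide) hs
  refine .of_wp (b := b) (by simp [lowWidth]) (fun y hy => ?_) ?_
  · by_cases e : y = 0
    · rw [e]; positivity
    · exact (hin y (by simp at hy ⊢; tauto)).trans_le hpow
  refine .block_cons <|
    .call le_rfl (out := q) (by simpa using h) (by decide) (by decide) (by omega) <| .block_cons <|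
    .branch (fun h => by simp at h) fun _ => .skip hs' <| .block_cons <|
    .const hs' (by decide) (by omega) <| .block_cons <| .add hs' (by decide) ?_ <| .block_nil hs' ?_
  · simpa using hq
  · simp

theorem streamUpdate_succ_computes {pΦ pAgg : Prog} {a q x r : ℕ}
    (h : pΦ.ComputesInSpace s₀ [n, S, k, R, a] q)
    (h' : pAgg.ComputesInSpace s₀ [n, S, k, R, x, q] r) (hs : s₀ ≤ b) (hx : x + 1 < 2 ^ b)
    (hr : r + 1 < 2 ^ b) :
    (Prog.streamUpdate pΦ pAgg).ComputesInSpace (s₀ + lowWidth * b) [n, S, k, R, x + 1, a]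
      (r + 1) := by
  have hs' : lowWidth * b ≤ s₀ + lowWidth * b := Nat.le_add_left _ _
  have hin := h.lt_two_pow
  have hin' := h'.lt_two_pow
  have hpow : 2 ^ s₀ ≤ 2 ^ b := Nat.pow_le_pow_right (by decide) hs
  refine .of_wp (b := b) (by simp [lowWidth]) (fun y hy => ?_) ?_
  · by_cases e : y = x + 1
    · rwa [e]
    · exact (hin y (by simp at hy ⊢; tauto)).trans_le hpow
  refine .block_cons <|
    .call le_rfl (out := q) (by simpa using h) (by decide) (by decide)
      ((hin' q (by simp)).trans_le hpow) <| .block_cons <|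
    .branch (fun _ => .block_cons <| .const hs' (by decide) (by omega) <| .block_cons <|
      .sub hs' (by decide) (by decide) <| .block_cons <| .call le_rfl (out := r)
      (by simpa using h') (by decide) (by decide) (by omega) <| .block_nil hs' <| .block_cons <|
      .const hs' (by decide) (by omega) <| .block_cons <| .add hs' (by decide) ?_ <|
      .block_nil hs' ?_) fun h => by simp at h
  · simpa using hr
  · simp

theorem streamOutput_zero_computes {pη : Prog} (hin : ∀ x ∈ [n, S, k, R], x < 2 ^ b) :
    (Prog.streamOutput pη).ComputesInSpace (s₀ + lowWidth * b) [n, S, k, R, 0] 0 := by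
  have hs' : lowWidth * b ≤ s₀ + lowWidth * b := Nat.le_add_left _ _
  refine .of_wp (b := b) (by simp [lowWidth]) (fun y hy => ?_) ?_
  · by_cases e : y = 0
    · rw [e]; positivity
    · exact hin y (by simp at hy ⊢; tauto)
  refine .block_cons <| .branch (fun h => by simp at h) fun _ => .const hs' (by decide)
    (by positivity) <| .block_nil hs' ?_
  simp

theorem streamOutput_succ_computes {pη : Prog} {x q : ℕ}
    (h : pη.ComputesInSpace s₀ [n, S, k, R, x] q) (hs : s₀ ≤ b) (hx : x + 1 < 2 ^ b)
    (hq : q < 2 ^ b) :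
    (Prog.streamOutput pη).ComputesInSpace (s₀ + lowWidth * b) [n, S, k, R, x + 1] q := by
  have hs' : lowWidth * b ≤ s₀ + lowWidth * b := Nat.le_add_left _ _
  have hin := h.lt_two_pow
  have hpow : 2 ^ s₀ ≤ 2 ^ b := Nat.pow_le_pow_right (by decide) hs
  refine .of_wp (b := b) (by simp [lowWidth]) (fun y hy => ?_) ?_
  · by_cases e : y = x + 1
    · rwa [e]
    · exact (hin y (by simp at hy ⊢; tauto)).trans_le hpow
  refine .block_cons <| .branch (fun _ => .block_cons <| .const hs' (by decide) (by omega) <|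
    .block_cons <| .sub hs' (by decide) (by decide) <| .block_cons <| .call le_rfl (out := q)
    (by simpa using h) (by decide) (by decide) hq <| .block_nil hs' <| .block_nil hs' ?_)
    fun h => by simp at h
  simp

end

/-! ## Polylogarithmic bounds -/

/-- The quantity is polylogarithmic in `n`. -/
def IsPolylog (f : ℕ → ℕ) : Prop := ∃ C, ∀ n, f n ≤ polylog C n

theorem isPolylog_polylog (C : ℕ) : IsPolylog (polylog C) := ⟨C, fun _ => le_rfl⟩

theorem isPolylog_const (c : ℕ) : IsPolylog fun _ => c :=
  ⟨c, fun _ => Nat.le_mul_of_pos_right _ (by positivity)⟩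

theorem isPolylog_log : IsPolylog fun n => Nat.log 2 n + 1 := ⟨1, fun n => by simp [polylog]⟩

theorem IsPolylog.add {f g : ℕ → ℕ} (hf : IsPolylog f) (hg : IsPolylog g) :
    IsPolylog fun n => f n + g n := by
  obtain ⟨C, hC⟩ := hf
  obtain ⟨C', hC'⟩ := hg
  refine ⟨C + C', fun n => ?_⟩
  calc f n + g n ≤ C * (Nat.log 2 n + 1) ^ C + C' * (Nat.log 2 n + 1) ^ C' :=
        Nat.add_le_add (hC n) (hC' n)
    _ ≤ C * (Nat.log 2 n + 1) ^ (C + C') + C' * (Nat.log 2 n + 1) ^ (C + C') := by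
        gcongr <;> omega
    _ = polylog (C + C') n := by rw [polylog]; ring

/-- One constant has to serve both as the factor, at least `C * C'`, and as the exponent, at least
`C + C'`; the sum of the two does both. -/
theorem IsPolylog.mul {f g : ℕ → ℕ} (hf : IsPolylog f) (hg : IsPolylog g) :
    IsPolylog fun n => f n * g n := by
  obtain ⟨C, hC⟩ := hf
  obtain ⟨C', hC'⟩ := hg
  refine ⟨C * C' + (C + C'), fun n => ?_⟩
  calc f n * g n ≤ C * (Nat.log 2 n + 1) ^ C * (C' * (Nat.log 2 n + 1) ^ C') :=
        Nat.mul_le_mul (hC n) (hC' n)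
    _ = C * C' * (Nat.log 2 n + 1) ^ (C + C') := by ring
    _ ≤ polylog (C * C' + (C + C')) n := by
        rw [polylog]
        exact Nat.mul_le_mul (by omega) (Nat.pow_le_pow_right (by omega) (by omega))

theorem isPolylog_aggregateBits (C : ℕ) : IsPolylog (aggregateBits C) :=
  (((((isPolylog_const 2).mul (isPolylog_polylog C)).add isPolylog_log).add
    (isPolylog_const 1)).mul ((isPolylog_const 5).mul isPolylog_log))

/-! ## From streaming to mud: correctness -/

namespace StreamingAlg

variable {S : ℕ} (s : StreamingAlg S)

/-- The output on a list of letters. -/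
def listResult (l : List (Fin S)) : Fin S := s.output (s.run ⟨0, s.card_pos⟩ l)

theorem run_append (q : Fin s.card) (l l' : List (Fin S)) :
    s.run q (l ++ l') = s.run (s.run q l) l' := List.foldl_append

/-- If the output on inputs of length `n` is invariant under permutations, then it depends only on
the multiset of letters. -/
theorem listResult_eq_of_perm {n : ℕ}
    (h : ∀ (x : Fin n → Fin S) (π : Equiv.Perm (Fin n)), s.result x = s.result (x ∘ π))
    {l l' : List (Fin S)} (hl : l.length = n) (hp : l.Perm l') :
    s.listResult l = s.listResult l' := by
  have key : ∀ l : List (Fin S), l.length = n → ∃ x : Fin n → Fin S, l = List.ofFn x := by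
    rintro l rfl
    exact ⟨l.get, (List.ofFn_get l).symm⟩
  obtain ⟨x, rfl⟩ := key l hl
  obtain ⟨y, rfl⟩ := key l' (hp.length_eq ▸ hl)
  change s.result x = s.result y
  -- Both inputs are brought into sorted order, where lists that are permutations of each other
  -- coincide.
  rw [h x (Tuple.sort x), h y (Tuple.sort y)]
  congr 1
  refine List.ofFn_injective (List.Perm.eq_of_pairwise' (r := (· ≤ ·)) ?_ ?_
    (((Tuple.sort x).ofFn_comp_perm x).trans (hp.trans ((Tuple.sort y).ofFn_comp_perm y).symm)))
  · exact (Tuple.monotone_sort x).sortedLE_ofFn.pairwise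
  · exact (Tuple.monotone_sort y).sortedLE_ofFn.pairwise

/-- The update operator as a function of numbers. -/
def natUpdate (q a : ℕ) : ℕ :=
  if h : q < s.card ∧ a < S then (s.update ⟨q, h.1⟩ ⟨a, h.2⟩).val else 0

theorem natUpdate_val (q : Fin s.card) (a : Fin S) : s.natUpdate q a = s.update q a := by
  simp [natUpdate]

theorem pairStep_iff {B : ℕ} (hB : s.card ≤ B) (u v : Fin s.card) (z : ℕ) :
    PairStep s.natUpdate S B (u * B + v) z ↔
      ∃ a, (s.update u a).val * B + (s.update v a).val = z := by
  have hv : v.val < B := v.2.trans_le hB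
  rw [PairStep, mul_comm u.val, Nat.mul_add_div (by omega), Nat.mul_add_mod, Nat.div_eq_of_lt hv,
    Nat.mod_eq_of_lt hv, add_zero]
  simp only [← natUpdate_val]
  exact ⟨fun ⟨a, ha, h⟩ => ⟨⟨a, ha⟩, h⟩, fun ⟨a, h⟩ => ⟨a, a.2, h⟩⟩

/-- A path in the graph of pairs is one word read from both states simultaneously; this is what ties
the state reached from `q₁` to a word leading from `0` to `q₂`. -/
theorem reach_iff {B : ℕ} (hB : s.card ≤ B) (t : ℕ) (u v : Fin s.card) (z : ℕ) :
    ReachSucc (PairStep s.natUpdate S B) t (u * B + v) z ↔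
      ∃ y : List (Fin S), y.length = t + 1 ∧ (s.run u y).val * B + (s.run v y).val = z := by
  induction t generalizing u v with
  | zero =>
    rw [ReachSucc, pairStep_iff s hB]
    constructor
    · rintro ⟨a, h⟩; exact ⟨[a], rfl, h⟩
    · rintro ⟨y, hy, h⟩
      obtain ⟨a, rfl⟩ := List.length_eq_one_iff.mp hy
      exact ⟨a, h⟩
  | succ t ih =>
    simp only [ReachSucc, pairStep_iff s hB]
    constructor
    · rintro ⟨_, ⟨a, rfl⟩, h⟩
      obtain ⟨y, hy, h⟩ := (ih _ _).mp h
      exact ⟨a :: y, by simp [hy], h⟩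
    · rintro ⟨y, hy, h⟩
      obtain ⟨a, y, rfl⟩ := List.exists_cons_of_length_eq_add_one hy
      exact ⟨_, ⟨a, rfl⟩, (ih _ _).mpr ⟨y, by simpa using hy, h⟩⟩

variable (n : ℕ)

/-- The state in a message. -/
def messageState (m : Fin ((n + 1) * s.card)) : Fin s.card :=
  ⟨m / (n + 1), Nat.div_lt_of_lt_mul m.2⟩

/-- The message `r` combines the messages `m₁` and `m₂`: the counts are added, and the state of `r`
is reached from that of `m₁` by a word that leads from the starting state to the state of `m₂`, if
there is such a word. -/
def Joins (m₁ m₂ r : Fin ((n + 1) * s.card)) : Prop :=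
  r.val % (n + 1) = (m₁.val % (n + 1) + m₂.val % (n + 1) + 1) % (n + 1) ∧
  ∀ y : List (Fin S), y.length = m₂.val % (n + 1) + 1 →
    s.run ⟨0, s.card_pos⟩ y = s.messageState n m₂ →
    ∃ y' : List (Fin S), y'.length = m₂.val % (n + 1) + 1 ∧
      s.run ⟨0, s.card_pos⟩ y' = s.messageState n m₂ ∧
      s.run (s.messageState n m₁) y' = s.messageState n r

/-- The message holds the number of letters in `l` and the state after an equivalent word. -/
def Represents (m : Fin ((n + 1) * s.card)) (l : List (Fin S)) : Prop :=
  m.val % (n + 1) + 1 = l.length ∧ ∃ y : List (Fin S), y.length = l.length ∧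
    s.run ⟨0, s.card_pos⟩ y = s.messageState n m ∧
    ∀ z, y.length + z.length = n → s.listResult (y ++ z) = s.listResult (l ++ z)

variable {s n}

/-- This is where order independence enters. After `y₁` is replaced by `l₁`, the word `y` is moved
to the front of the stream. There it can be exchanged for `y₂`, which leads from the starting state
to the same state, and then for `l₂`, which is finally moved back. Each exchange is made inside a
full input of length `n`, the only length for which invariance is assumed. -/
theorem Represents.join
    (hs : ∀ (x : Fin n → Fin S) (π : Equiv.Perm (Fin n)), s.result x = s.result (x ∘ π))
    {m₁ m₂ r : Fin ((n + 1) * s.card)} {l₁ l₂ : List (Fin S)} (h₁ : s.Represents n m₁ l₁)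
    (h₂ : s.Represents n m₂ l₂) (hr : s.Joins n m₁ m₂ r) (hn : l₁.length + l₂.length ≤ n) :
    s.Represents n r (l₁ ++ l₂) := by
  obtain ⟨c₁, y₁, hy₁, q₁, e₁⟩ := h₁
  obtain ⟨c₂, y₂, hy₂, q₂, e₂⟩ := h₂
  obtain ⟨cr, hr⟩ := hr
  obtain ⟨y, hy, qy, qr⟩ := hr y₂ (by omega) q₂
  refine ⟨?_, y₁ ++ y, ?_, ?_, fun z hz => ?_⟩
  · rw [cr, Nat.mod_eq_of_lt (by omega), List.length_append]
    omega
  · simp only [List.length_append]; omega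
  · rw [run_append, q₁, qr]
  · simp only [List.length_append] at hz
    calc s.listResult (y₁ ++ y ++ z) = s.listResult (l₁ ++ (y ++ z)) := by
          rw [List.append_assoc, e₁ _ (by simp only [List.length_append]; omega)]
      _ = s.listResult (y ++ (l₁ ++ z)) := by
          refine s.listResult_eq_of_perm hs (by simp only [List.length_append]; omega) ?_
          rw [← List.append_assoc, ← List.append_assoc]
          exact List.perm_append_comm.append_right z
      _ = s.listResult (y₂ ++ (l₁ ++ z)) := by
          rw [listResult, listResult, s.run_append _ y, s.run_append _ y₂, qy, q₂]
      _ = s.listResult (l₂ ++ (l₁ ++ z)) := e₂ _ (by simp only [List.length_append]; omega)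
      _ = s.listResult (l₁ ++ l₂ ++ z) := by
          refine s.listResult_eq_of_perm hs (by simp only [List.length_append]; omega) ?_
          rw [← List.append_assoc]
          exact List.perm_append_comm.append_right z

variable (s n) in
/-- The mud algorithm with a given aggregator. -/
def toMud (agg : Fin ((n + 1) * s.card) → Fin ((n + 1) * s.card) → Fin ((n + 1) * s.card)) :
    MudAlg S where
  card := (n + 1) * s.card
  localMsg a := ⟨(n + 1) * s.update ⟨0, s.card_pos⟩ a,
    Nat.mul_lt_mul_of_pos_left (s.update _ a).2 n.succ_pos⟩
  aggregate := agg
  output m := s.output (s.messageState n m)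

/-- By induction over subtrees, the message at each node represents the letters at the leaves below
it. At the root, the represented word has full length and its state gives the output. -/
theorem toMud_result
    (hs : ∀ (x : Fin n → Fin S) (π : Equiv.Perm (Fin n)), s.result x = s.result (x ∘ π))
    {agg : Fin ((n + 1) * s.card) → Fin ((n + 1) * s.card) → Fin ((n + 1) * s.card)}
    (hagg : ∀ m₁ m₂, s.Joins n m₁ m₂ (agg m₁ m₂)) (T : CompTree n) (x : Fin n → Fin S) :
    (s.toMud n agg).result T x = s.result x := by
  have key : ∀ T : BinTree (Fin n), T.leaves.length ≤ n →
      s.Represents n ((s.toMud n agg).eval x T) (T.leaves.map x) := by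
    intro T
    induction T with
    | leaf i =>
      intro _
      refine ⟨?_, [x i], rfl, ?_, fun z _ => rfl⟩
      · simp [MudAlg.eval, toMud, BinTree.leaves]
      · simp [MudAlg.eval, toMud, messageState, run]
    | node T₁ T₂ h₁ h₂ =>
      intro h
      simp only [BinTree.leaves, List.length_append] at h
      have := Represents.join hs (h₁ (by omega)) (h₂ (by omega)) (hagg _ _) (by simpa using h)
      rw [← List.map_append] at this
      exact this
  obtain ⟨T, hT⟩ := T
  have hlen : T.leaves.length = n := by simpa using hT.length_eq
  obtain ⟨-, y, hy, hq, he⟩ := key T hlen.le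
  rw [List.length_map] at hy
  -- At the root no letters remain, so the only continuation is the empty word.
  have he := he [] (by simp [hy, hlen])
  simp only [List.append_nil] at he
  calc (s.toMud n agg).result ⟨T, hT⟩ x = s.listResult y := by
        rw [listResult, hq]; rfl
    _ = s.listResult (T.leaves.map x) := he
    _ = s.listResult ((List.finRange n).map x) :=
        s.listResult_eq_of_perm hs (by simpa using hlen) (hT.map x)
    _ = s.result x := by rw [← List.ofFn_eq_map]; rfl

end StreamingAlg

/-! ## From mud to streaming: correctness -/

namespace MudAlg

variable {S : ℕ} (m : MudAlg S)

/-- The streaming algorithm that aggregates the messages one by one. State `0` is the empty stream. -/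
def toStreaming (hS : 0 < S) : StreamingAlg S where
  card := m.card + 1
  card_pos := Nat.succ_pos _
  update q a := Fin.cases (m.localMsg a).succ
    (fun q => (m.aggregate q (m.localMsg a)).succ) q
  output q := Fin.cases ⟨0, hS⟩ m.output q

/-- The tree that adds the leaves in the list one by one to the right of `T`. -/
def comb {ι : Type} (T : BinTree ι) (l : List ι) : BinTree ι :=
  l.foldl (fun T i => .node T (.leaf i)) T

theorem leaves_comb {ι : Type} (T : BinTree ι) (l : List ι) :
    (comb T l).leaves = T.leaves ++ l := by
  induction l generalizing T with
  | nil => simp [comb]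
  | cons i l ih => simpa [comb, BinTree.leaves] using ih (.node T (.leaf i))

theorem toStreaming_run (hS : 0 < S) {n : ℕ} (x : Fin n → Fin S) (T : BinTree (Fin n))
    (l : List (Fin n)) :
    (m.toStreaming hS).run (m.eval x T).succ (l.map x) = (m.eval x (comb T l)).succ := by
  induction l generalizing T with
  | nil => rfl
  | cons i l ih => exact ih (.node T (.leaf i))

/-- The tree is the left comb on the inputs in their given order, so it does not depend on `x`. It
has a first leaf because `1 ≤ n`. -/
theorem exists_tree_toStreaming_result (hS : 0 < S) {n : ℕ} (hn : 1 ≤ n) :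
    ∃ T : CompTree n, ∀ x : Fin n → Fin S, (m.toStreaming hS).result x = m.result T x := by
  obtain ⟨i, l, hl⟩ := List.exists_cons_of_ne_nil (l := List.finRange n) (by
    rw [← List.length_pos_iff, List.length_finRange]; omega)
  refine ⟨⟨comb (.leaf i) l, ?_⟩, fun x => ?_⟩
  · rw [leaves_comb, hl]
    exact .refl _
  · have := m.toStreaming_run hS x (.leaf i) l
    change _ = m.output (m.eval x (comb (.leaf i) l))
    rw [StreamingAlg.result, List.ofFn_eq_map, hl]
    exact congrArg (m.toStreaming hS).output this

end MudAlg

/-! ## The main theorem -/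

theorem aggregateBits_bounds {C n : ℕ} :
    polylog C n ≤ aggregateBits C n ∧ polylog C n + (Nat.log 2 n + 1) ≤ aggregateBits C n := by
  unfold aggregateBits
  constructor <;> nlinarith

theorem succ_lt_two_pow_aggregateBits (C n : ℕ) : n + 1 < 2 ^ aggregateBits C n := by
  refine lt_of_lt_of_le ?_ ((Nat.le_mul_self _).trans (aggregateBase_sq_le C n))
  exact Nat.lt_add_of_pos_left (by positivity)

/-- If some word `y` leads from `0` to the state of `m₂`, then reading it from the state of `m₁`
produces a target that the search can find. So the state selected by the program is reached as well,
by a word `y'` of the same length. -/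
theorem exists_joins {S C n k : ℕ} (s : StreamingAlg S) (pσ : Prog) (R : Fin k → Bool)
    (hS : 0 < S) (hn : 1 ≤ n) (hcard : s.card ≤ 2 ^ polylog C n)
    (hσ : ∀ (q : Fin s.card) (a : Fin S),
      pσ.ComputesInSpace (polylog C n) (params n S R ++ [q.val, a.val]) (s.update q a).val)
    (m₁ m₂ : Fin ((n + 1) * s.card)) :
    ∃ r, s.Joins n m₁ m₂ r ∧
      (Prog.aggregate C pσ).ComputesInSpace (polylog C n + lowWidth * aggregateBits C n)
        (params n S R ++ [m₁.val, m₂.val]) r.val := by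
  have hσ' : ∀ q < s.card, ∀ a < S, pσ.ComputesInSpace (polylog C n)
      [n, S, k, Nat.ofBits R, q, a] (s.natUpdate q a) := fun q hq a ha => by
    have := hσ ⟨q, hq⟩ ⟨a, ha⟩
    rwa [← s.natUpdate_val] at this
  -- The parameters are inputs of `pσ`, so the space of a single run bounds them. A state and a
  -- letter exist for such a run.
  have hpar : ∀ x ∈ [n, S, k, Nat.ofBits R], x < 2 ^ polylog C n := fun x hx =>
    (hσ' 0 s.card_pos 0 hS).lt_two_pow x (by simp at hx ⊢; tauto)
  obtain ⟨q, hq, hr, hc⟩ := exists_aggregate hn hσ' (fun q hq a ha => by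
      have := (s.update ⟨q, hq⟩ ⟨a, ha⟩).2
      rwa [← s.natUpdate_val] at this) hcard hpar
    (Nat.mod_lt m₁.val n.succ_pos) (Nat.mod_lt m₂.val n.succ_pos)
    (s.messageState n m₁).2 (s.messageState n m₂).2
  have hmod : _ < n + 1 := Nat.mod_lt (m₁.val % (n + 1) + m₂.val % (n + 1) + 1) n.succ_pos
  refine ⟨⟨(m₁.val % (n + 1) + m₂.val % (n + 1) + 1) % (n + 1) + (n + 1) * q, ?_⟩,
    ⟨message_mod hmod q, fun y hy hy' => ?_⟩, ?_⟩
  · have : (n + 1) * (q + 1) ≤ (n + 1) * s.card := Nat.mul_le_mul_left _ hq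
    rw [mul_add] at this
    omega
  · have reach := s.reach_iff hcard (m₂.val % (n + 1)) ⟨0, s.card_pos⟩ (s.messageState n m₁)
    simp only [zero_mul, zero_add] at reach
    have := hr _ (s.run (s.messageState n m₁) y).2 ((reach _).mpr ⟨y, hy, by rw [hy']⟩)
    obtain ⟨y', hy₁, hy₂⟩ := (reach _).mp this
    have hB : 0 < 2 ^ polylog C n := by positivity
    have l₁ := (s.run (s.messageState n m₁) y').2.trans_le hcard
    have l₂ := hq.trans_le hcard
    refine ⟨y', hy₁, Fin.ext ?_, Fin.ext ?_⟩
    -- Quotient and remainder by the base recover the two components of the pair.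
    · have := congrArg (· / 2 ^ polylog C n) hy₂
      simpa [mul_comm _ (2 ^ polylog C n), Nat.mul_add_div hB, Nat.div_eq_of_lt, l₁, l₂] using this
    · have := congrArg (· % 2 ^ polylog C n) hy₂
      simp only [mul_comm _ (2 ^ polylog C n), Nat.mul_add_mod, Nat.mod_eq_of_lt l₁,
        Nat.mod_eq_of_lt l₂] at this
      rw [this]
      exact (message_div hmod q).symm
  · have e : ∀ m : Fin ((n + 1) * s.card),
        m.val % (n + 1) + (n + 1) * (s.messageState n m).val = m.val := fun m =>
      Nat.mod_add_div _ _
    rw [e, e] at hc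
    exact hc

theorem rSS_subset_rMUD : rSS ⊆ rMUD := by
  rintro f ⟨k, s, ⟨C, pσ, pη, hp⟩, hf⟩
  have hcard : ∀ {n}, 1 ≤ n → ∀ R, (s n R).card ≤ 2 ^ polylog C n := fun hn R =>
    (Nat.clog_le_iff_le_pow (by decide)).mp ((hp _ hn).2 R).1
  have hagg : ∀ n R, ∃ agg : Fin ((n + 1) * (s n R).card) → Fin ((n + 1) * (s n R).card) →
      Fin ((n + 1) * (s n R).card), 1 ≤ n → ∀ m₁ m₂, (s n R).Joins n m₁ m₂ (agg m₁ m₂) ∧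
        (Prog.aggregate C pσ).ComputesInSpace (polylog C n + lowWidth * aggregateBits C n)
          (params n (f.alphabetSize n) R ++ [m₁.val, m₂.val]) (agg m₁ m₂).val := by
    intro n R
    by_cases hn : 1 ≤ n
    · choose agg h using exists_joins (s n R) pσ R (f.alphabetSize_pos n) hn (hcard hn R)
        ((hp n hn).2 R).2.1
      exact ⟨agg, fun _ => h⟩
    -- Nothing is required for `n = 0`, so any aggregator will do.
    · exact ⟨fun m _ => m, fun h => absurd h hn⟩
  choose agg hagg using hagg
  have hres : ∀ n, 1 ≤ n → ∀ R T x,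
      ((s n R).toMud n (agg n R)).result T x = (s n R).result x := fun n hn R T x =>
    StreamingAlg.toMud_result (fun x π => (hf n hn x).2 R π) (fun m₁ m₂ => (hagg n R hn m₁ m₂).1)
      T x
  refine ⟨k, fun n R => (s n R).toMud n (agg n R), ?_, fun n hn x => ⟨fun T => ?_, ?_⟩⟩
  · obtain ⟨C', hC'⟩ := (isPolylog_polylog C).add
      ((isPolylog_const lowWidth).mul (isPolylog_aggregateBits C))
    refine ⟨C', .mudLocal pσ, .aggregate C pσ, .mudOutput pη, fun n hn => ?_⟩
    obtain ⟨hT, hTL⟩ := aggregateBits_bounds (C := C) (n := n)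
    have hC' : polylog C n + 32 * aggregateBits C n ≤ polylog C' n := hC' n
    have hnb := succ_lt_two_pow_aggregateBits C n
    have hpow : 2 ^ polylog C n ≤ 2 ^ aggregateBits C n := Nat.pow_le_pow_right (by decide) hT
    have hmsg : ∀ {R j q}, j < n + 1 → q < (s n R).card →
        j + (n + 1) * q < 2 ^ aggregateBits C n := fun hj hq =>
      (message_lt_aggregateBase_sq (hcard hn _) hj hq).trans_le (aggregateBase_sq_le C n)
    refine ⟨((hp n hn).1).trans (by omega), fun R => ⟨?_, fun a => ?_, fun q q' => ?_,
      fun q => ?_⟩⟩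
    · refine (Nat.clog_le_of_le_pow (y := Nat.log 2 n + 1 + polylog C n) ?_).trans (by omega)
      rw [pow_add]
      exact Nat.mul_le_mul (Nat.lt_pow_succ_log_self (by decide) n) (hcard hn R)
    · refine (mudLocal_computes (((hp n hn).2 R).2.1 ⟨0, (s n R).card_pos⟩ a) hT hnb ?_).mono hC'
      simpa using hmsg n.succ_pos ((s n R).update ⟨0, (s n R).card_pos⟩ a).2
    · exact ((hagg n R hn q q').2).mono hC'
    · have h := ((hp n hn).2 R).2.2 ((s n R).messageState n q)
      -- The output is a letter, hence less than the alphabet size, which is itself an input of `pσ`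
      -- and so fits into the register.
      have hσ := (((hp n hn).2 R).2.1 ⟨0, (s n R).card_pos⟩ ⟨0, f.alphabetSize_pos n⟩).lt_two_pow
        (f.alphabetSize n) (by simp [params])
      refine (mudOutput_computes h hT hnb ?_ (by omega)).mono hC'
      rw [← Nat.mod_add_div q.val (n + 1)]
      exact hmsg (Nat.mod_lt _ n.succ_pos) ((s n R).messageState n q).2
  · simpa only [hres n hn] using (hf n hn x).1
  · intro R π T T'
    rw [hres n hn, hres n hn]
    exact (hf n hn x).2 R π

theorem rMUD_subset_rSS : rMUD ⊆ rSS := by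
  rintro f ⟨k, m, ⟨C, pΦ, pAgg, pη, hp⟩, hf⟩
  have hcard : ∀ {n}, 1 ≤ n → ∀ R, (m n R).card ≤ 2 ^ polylog C n := fun hn R =>
    (Nat.clog_le_iff_le_pow (by decide)).mp ((hp _ hn).2 R).1
  refine ⟨k, fun n R => (m n R).toStreaming (f.alphabetSize_pos n), ?_, fun n hn x => ?_⟩
  · obtain ⟨C', hC'⟩ := (isPolylog_polylog C).add
      ((isPolylog_const lowWidth).mul ((isPolylog_polylog C).add (isPolylog_const 1)))
    refine ⟨C', .streamUpdate pΦ pAgg, .streamOutput pη, fun n hn => ?_⟩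
    have hC' : polylog C n + 32 * (polylog C n + 1) ≤ polylog C' n := hC' n
    have hT : polylog C n ≤ polylog C n + 1 := Nat.le_succ _
    have hpow : 2 ^ (polylog C n + 1) = 2 * 2 ^ polylog C n := by ring
    have hpos : 1 ≤ 2 ^ polylog C n := Nat.one_le_two_pow
    refine ⟨((hp n hn).1).trans (by omega), fun R => ?_⟩
    have hc := hcard hn R
    obtain ⟨-, hΦ, hAgg, hη⟩ := (hp n hn).2 R
    have hlt : ∀ q : Fin (m n R).card, q.val + 1 < 2 ^ (polylog C n + 1) := fun q => by omega
    have hin := (hΦ ⟨0, f.alphabetSize_pos n⟩).lt_two_pow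
    refine ⟨?_, Fin.cases (fun a => ?_) fun q a => ?_, Fin.cases ?_ fun q => ?_⟩
    · refine (Nat.clog_le_of_le_pow (y := polylog C n + 1) ?_).trans (by omega)
      change (m n R).card + 1 ≤ _
      omega
    · exact (streamUpdate_zero_computes (hΦ a) hT (hlt _)).mono hC'
    · exact (streamUpdate_succ_computes (hΦ a) (hAgg q _) hT (hlt _) (hlt _)).mono hC'
    · refine (streamOutput_zero_computes (b := polylog C n + 1) fun x hx => ?_).mono hC'
      refine (hin x ?_).trans (by omega)
      simp [params] at hx ⊢
      tauto
    · refine (streamOutput_succ_computes (hη q) hT (hlt _) ?_).mono hC'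
      have := hin (f.alphabetSize n) (by simp [params])
      omega
  · have hres := fun R =>
      (m n R).exists_tree_toStreaming_result (f.alphabetSize_pos n) hn
    -- The correctness bound holds for a tree fixed before `R` is drawn, so one tree `T₀` has to
    -- serve all `R`. Tree independence for each `R` allows the replacement.
    obtain ⟨T₀, -⟩ := hres fun _ => false
    have hres : ∀ R x, ((m n R).toStreaming (f.alphabetSize_pos n)).result x =
        (m n R).result T₀ x := fun R x => by
      obtain ⟨T, hT⟩ := hres R
      rw [hT]
      simpa using (hf n hn x).2 R 1 T T₀
    refine ⟨?_, fun R π => ?_⟩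
    · simpa only [hres] using (hf n hn x).1 T₀
    · rw [hres, hres]
      exact (hf n hn x).2 R π T₀ T₀

theorem mainTheorem2 : rMUD = rSS :=
  Set.Subset.antisymm rMUD_subset_rSS rSS_subset_rMUD
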